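/- Let $A,B$ be $\mathbb{Z}/2$-graded $C^*$-algebras and let $E$ be a graded $(A,B)$-bimodule: a graded Hilbert $C^*$-module over $B$ with a graded $*$-homomorphism $A\to\mathrm{End}^*_B(E)$ into the adjointable endomorphisms. Let $D$ be an odd selfadjoint regular operator in $E$ (for instance, let $(E,D)$ be an unbounded $KK$-cycle). All commutators are graded. For $n\ge 0$ let $D$ act diagonally in $E^{2^n}$, and let $$p_{n+1}=\begin{pmatrix}(1+D^2)^{-1}& D(1+D^2)^{-1}\\ D(1+D^2)^{-1}& D^2(1+D^2)^{-1}\end{pmatrix}$$ on $E^{2^{n+1}}=E^{2^n}\oplus E^{2^n}$; further, let $p_n$ also denote $p_n\oplus p_n$ on $E^{2^{n+1}}$, and put $p^\perp=1-p$. The Sobolev subalgebras $A_n$ of $A$ and maps $\theta_n:A_n\to\mathrm{End}^*_B(E^{2^n})$ are defined inductively: $A_0=A$, $\theta_0(a)=a$, $$A_{n+1}=\{a\in A_n:[D,\theta_n(a)]\in\mathrm{End}^*_B(E^{2^n})\},\qquad \pi_{n+1}(a)=\begin{pmatrix}\theta_n(a)&0\\ [D,\theta_n(a)]&(-1)^{\partial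 a}\theta_n(a)\end{pmatrix},$$ $$\theta_1(a)=p_1\pi_1(a)p_1+p_1^\perp\pi_1(a)p_1^\perp,\qquad \theta_{n+1}(a)=p_{n+1}p_n\pi_{n+1}(a)p_np_{n+1}+p_{n+1}^\perp p_n^\perp\pi_{n+1}(a)p_n^\perp p_{n+1}^\perp\quad(n\ge 1).$$ Here, an operator that is defined on the domain of $D$ is said to lie in $\mathrm{End}^*_B$ if it extends to an adjointable endomorphism; in particular, $[D,T]\in\mathrm{End}^*_B$ includes that $T$ maps the domain of $D$ into itself. For $k\ge 1$ and $a\in A$, consider the condition $$(R_k)\qquad (\mathrm{ad}\,D)^k(a)(D\pm i)^{-k+1},\quad (\mathrm{ad}\,D)^k(a^*)(D\pm i)^{-k+1}\ \in\ \mathrm{End}^*_B(E),$$ where the iterated commutators have their natural domains, and the products are required to be defined on all of the domain of $D$. Then for all $n\ge 1$ and $a\in A$: $a\in A_n$ if and only if $(R_k)$ holds for all $1\le k\le n$. Equivalently, an element $a\in A_{n-1}$ lies in $A_n$ if and only if $(R_n)$ holds. -/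

import Mathlib

open scoped WithCStarModule

noncomputable section

namespace SobolevChain

/-! ### Partially defined operators -/

section Partial

variable {X : Type*} [AddCommGroup X] [Module ℂ X]

/-- The product `g f` of two unbounded operators, on its natural domain
`{x ∈ Dom f : f x ∈ Dom g}`. -/
def pcomp (g f : X →ₗ.[ℂ] X) : X →ₗ.[ℂ] X where
  domain :=
    { carrier := {x | ∃ h : x ∈ f.domain, f ⟨x, h⟩ ∈ g.domain}
      zero_mem' := ⟨f.domain.zero_mem, by
        have h : f ⟨0, f.domain.zero_mem⟩ = 0 := f.map_zero
        rw [h]; exact g.domain.zero_mem⟩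
      add_mem' := by
        rintro x y ⟨hx, hx'⟩ ⟨hy, hy'⟩
        refine ⟨f.domain.add_mem hx hy, ?_⟩
        have h : f ⟨x + y, f.domain.add_mem hx hy⟩ = f ⟨x, hx⟩ + f ⟨y, hy⟩ :=
          f.map_add ⟨x, hx⟩ ⟨y, hy⟩
        rw [h]; exact g.domain.add_mem hx' hy'
      smul_mem' := by
        rintro c x ⟨hx, hx'⟩
        refine ⟨f.domain.smul_mem c hx, ?_⟩
        have h : f ⟨c • x, f.domain.smul_mem c hx⟩ = c • f ⟨x, hx⟩ := f.map_smul c ⟨x, hx⟩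
        rw [h]; exact g.domain.smul_mem c hx' }
  toFun :=
    { toFun := fun x => g ⟨f ⟨x, x.2.fst⟩, x.2.snd⟩
      map_add' := by
        intro x y
        rw [← g.map_add]
        exact congrArg g (Subtype.ext (f.map_add ⟨x, x.2.fst⟩ ⟨y, y.2.fst⟩))
      map_smul' := by
        intro c x
        simp only [RingHom.id_apply]
        rw [← g.map_smul]
        exact congrArg g (Subtype.ext (f.map_smul c ⟨x, x.2.fst⟩)) }

/-- An everywhere defined operator, seen as a partially defined one. -/
def everywhere (T : X →ₗ[ℂ] X) : X →ₗ.[ℂ] X := T.toPMap ⊤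

/-- Powers of a partially defined operator, on their natural domains; the zeroth one is the
identity of the whole space. -/
def ppow (f : X →ₗ.[ℂ] X) : ℕ → (X →ₗ.[ℂ] X)
  | 0 => everywhere LinearMap.id
  | k + 1 => pcomp f (ppow f k)

open Classical in
/-- A partially defined operator whose domain is the whole space, as an operator defined
everywhere (and `0` if the domain is smaller). -/
def total (f : X →ₗ.[ℂ] X) : X →ₗ[ℂ] X :=
  if h : f.domain = ⊤ then f.toFun ∘ₗ LinearMap.id.codRestrict f.domain (fun _ => h ▸ trivial)
  else 0

/-- `1 + D²`, with domain `Dom D²`. -/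
def onePlusSq (D : X →ₗ.[ℂ] X) : X →ₗ.[ℂ] X := everywhere LinearMap.id + pcomp D D

/-- `(1 + D²)⁻¹`. -/
def invOnePlusSq (D : X →ₗ.[ℂ] X) : X →ₗ.[ℂ] X := (onePlusSq D).inverse

/-- The resolvent `(D + z)⁻¹`. -/
def resolvent (D : X →ₗ.[ℂ] X) (z : ℂ) : X →ₗ.[ℂ] X :=
  (D + everywhere (z • LinearMap.id)).inverse

/-- The graded commutator `[D, T] = D T - (-1)^{∂T} T D` of an odd operator `D` with `T`, on its
natural domain `{x ∈ Dom D : T x ∈ Dom D}`; the second argument `T'` stands for `(-1)^{∂T} T`. -/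
def gradedCommutator (D : X →ₗ.[ℂ] X) (T T' : X →ₗ[ℂ] X) : X →ₗ.[ℂ] X :=
  pcomp D (everywhere T) - pcomp (everywhere T') D

end Partial

/-! ### Adjointable endomorphisms and selfadjoint regular operators -/

section Adjointable

variable (B : Type*) {X : Type*} [AddCommGroup X] [Module ℂ X] [Inner B X]

/-- `T ∈ End*_B(X)`. -/
def IsAdjointable (T : X → X) : Prop :=
  ∃ S : X → X, ∀ x y, inner B (T x) y = inner B x (S y)

/-- `T` is an adjointable endomorphism that extends the partially defined operator `f`. -/
def IsAdjointableExtension (f : X →ₗ.[ℂ] X) (T : X →ₗ[ℂ] X) : Prop :=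
  IsAdjointable B T ∧ ∀ x : f.domain, T x = f x

/-- `f ∈ End*_B(X)` for an operator `f` that is a priori only defined on the (dense) domain of `D`:
it is defined on all of `Dom D`, and extends to an adjointable endomorphism. -/
def MemEnd (D f : X →ₗ.[ℂ] X) : Prop :=
  D.domain ≤ f.domain ∧ ∃ T : X →ₗ[ℂ] X, IsAdjointableExtension B f T

open Classical in
/-- The adjointable endomorphism that extends the densely defined operator `f` (and `0` if there
is none). -/
def extension (f : X →ₗ.[ℂ] X) : X →ₗ[ℂ] X :=
  if h : ∃ T : X →ₗ[ℂ] X, IsAdjointableExtension B f T then h.choose else 0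

end Adjointable

/-- `D` is a selfadjoint regular operator in the Hilbert `C*`-module `E` over `B`: it is densely
defined and closed, symmetric with `Dom D* ⊆ Dom D`, and `1 + D* D = 1 + D²` has dense range.
(Linearity over `B` follows from selfadjointness.) -/
structure IsSelfAdjointRegular (B : Type*) {E : Type*} [NormedAddCommGroup E] [NormedSpace ℂ E]
    [Inner B E] (D : E →ₗ.[ℂ] E) : Prop where
  dense_domain : Dense (D.domain : Set E)
  isClosed : D.IsClosed
  symmetric : ∀ x y : D.domain, inner B (D x) (y : E) = inner B (x : E) (D y)
  adjoint_domain_le : ∀ y z : E,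
    (∀ x : D.domain, inner B (D x) y = inner B (x : E) z) → y ∈ D.domain
  dense_range : Dense (LinearMap.range (onePlusSq D).toFun : Set E)

/-- The data that make the Hilbert `C*`-module `E` over the `ℤ/2`-graded `C*`-algebra `B` a graded
`(A, B)`-bimodule, for a `ℤ/2`-graded `C*`-algebra `A`. Gradings are given by their
grading automorphisms, `(-1)^{∂a} a` on homogeneous elements. -/
structure GradedBimodule (A B E : Type*) [NonUnitalCStarAlgebra A]
    [NonUnitalCStarAlgebra B] [PartialOrder B] [StarOrderedRing B]
    [NormedAddCommGroup E] [NormedSpace ℂ E] [SMul B E] [CStarModule B E] where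
  gradA : A →⋆ₙₐ[ℂ] A
  gradA_gradA : ∀ a, gradA (gradA a) = a
  gradB : B →⋆ₙₐ[ℂ] B
  gradB_gradB : ∀ b, gradB (gradB b) = b
  gradE : E →ₗ[ℂ] E
  gradE_gradE : ∀ x, gradE (gradE x) = x
  gradE_smul : ∀ (b : B) (x : E), gradE (b • x) = gradB b • gradE x
  inner_gradE : ∀ x y : E, inner B (gradE x) (gradE y) = gradB (inner B x y)
  /-- the action of `A` by adjointable endomorphisms -/
  rep : A →ₙₐ[ℂ] Module.End ℂ E
  inner_rep : ∀ (a : A) (x y : E), inner B (rep a x) y = inner B x (rep (star a) y)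
  gradE_rep : ∀ (a : A) (x : E), gradE (rep a x) = rep (gradA a) (gradE x)

/-! ### The modules `E^(2^n)` -/

/-- An index set with `2^n` elements. -/
def Idx : ℕ → Type
  | 0 => Unit
  | n + 1 => Idx n ⊕ Idx n

instance instFintypeIdx : (n : ℕ) → Fintype (Idx n)
  | 0 => inferInstanceAs (Fintype Unit)
  | n + 1 =>
    haveI := instFintypeIdx n
    inferInstanceAs (Fintype (Idx n ⊕ Idx n))

/-- The Hilbert `C*`-module `E^(2^n)`, with inner product `⟨x, y⟩ = ∑ᵢ ⟨xᵢ, yᵢ⟩`. As a vector space,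
`E^(2^(n+1))` is `E^(2^n) ⊕ E^(2^n)`. -/
abbrev Pow (B E : Type*) (n : ℕ) : Type _ := C⋆ᵐᵒᵈ(B, Idx n → E)

section Powers

variable {B E : Type*} [NormedAddCommGroup E] [NormedSpace ℂ E]

/-- The first component of a vector in `E^(2^n) ⊕ E^(2^n)`. -/
def fstL (n : ℕ) : Pow B E (n + 1) →ₗ[ℂ] Pow B E n where
  toFun x := fun i => x (Sum.inl i)
  map_add' _ _ := rfl
  map_smul' _ _ := rfl

/-- The second component of a vector in `E^(2^n) ⊕ E^(2^n)`. -/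
def sndL (n : ℕ) : Pow B E (n + 1) →ₗ[ℂ] Pow B E n where
  toFun x := fun i => x (Sum.inr i)
  map_add' _ _ := rfl
  map_smul' _ _ := rfl

/-- The vector `(x, y)` in `E^(2^n) ⊕ E^(2^n)`. -/
def pair {n : ℕ} (x y : Pow B E n) : Pow B E (n + 1) :=
  fun i : Idx n ⊕ Idx n => Sum.elim (x : Idx n → E) (y : Idx n → E) i

/-- The operator on `E^(2^n) ⊕ E^(2^n)` with matrix `(P Q; R S)`. -/
def block {n : ℕ} (P Q R S : Pow B E n →ₗ[ℂ] Pow B E n) : Pow B E (n + 1) →ₗ[ℂ] Pow B E (n + 1) where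
  toFun x := pair (P (fstL n x) + Q (sndL n x)) (R (fstL n x) + S (sndL n x))
  map_add' x y := by
    simp only [map_add]
    funext i
    cases i
    · exact add_add_add_comm _ _ _ _
    · exact add_add_add_comm _ _ _ _
  map_smul' c x := by
    simp only [map_smul, RingHom.id_apply]
    funext i
    cases i
    · exact (smul_add c _ _).symm
    · exact (smul_add c _ _).symm

/-- An operator on `E` acting diagonally on `E^(2^n)`. -/
def diag (n : ℕ) (T : E →ₗ[ℂ] E) : Pow B E n →ₗ[ℂ] Pow B E n where
  toFun x := fun i => T (x i)
  map_add' x y := funext fun i => T.map_add (x i) (y i)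
  map_smul' c x := funext fun i => T.map_smul c (x i)

/-- An unbounded operator `D` in `E` acting diagonally in `E^(2^n)`, with domain
`(Dom D)^(2^n)`. -/
def pdiag (n : ℕ) (D : E →ₗ.[ℂ] E) : Pow B E n →ₗ.[ℂ] Pow B E n where
  domain :=
    { carrier := {x | ∀ i, x i ∈ D.domain}
      zero_mem' := fun _ => D.domain.zero_mem
      add_mem' := fun hx hy i => D.domain.add_mem (hx i) (hy i)
      smul_mem' := fun c _ hx i => D.domain.smul_mem c (hx i) }
  toFun :=
    { toFun := fun x => fun i => D ⟨x.1 i, x.2 i⟩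
      map_add' := fun x y => funext fun i => D.map_add ⟨x.1 i, x.2 i⟩ ⟨y.1 i, y.2 i⟩
      map_smul' := fun c x => funext fun i => D.map_smul c ⟨x.1 i, x.2 i⟩ }

variable (B) in
/-- The Woronowicz projection `p_{n+1}` on `E^(2^n) ⊕ E^(2^n)`, i.e. the matrix
`((1+D²)⁻¹, D(1+D²)⁻¹; D(1+D²)⁻¹, D²(1+D²)⁻¹)` for `D` acting diagonally in `E^(2^n)`. -/
def woronowicz (D : E →ₗ.[ℂ] E) (n : ℕ) : Pow B E (n + 1) →ₗ[ℂ] Pow B E (n + 1) :=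
  let Dn : Pow B E n →ₗ.[ℂ] Pow B E n := pdiag n D
  let R := invOnePlusSq Dn
  block (total R) (total (pcomp Dn R)) (total (pcomp Dn R)) (total (pcomp (pcomp Dn Dn) R))

/-- The operator `T ⊕ T` on `E^(2^n) ⊕ E^(2^n)` given by `T` on each summand. -/
def double {n : ℕ} (T : Pow B E n →ₗ[ℂ] Pow B E n) : Pow B E (n + 1) →ₗ[ℂ] Pow B E (n + 1) :=
  block T 0 0 T

/-- The compression that turns `π_n` into `θ_n` (index shifted by one). With `p_n` acting
diagonally on `E^(2^n) ⊕ E^(2^n)`, this is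
`p₁ π₁ p₁ + p₁^⊥ π₁ p₁^⊥` for the first step, and
`p_{n+1} p_n π_{n+1} p_n p_{n+1} + p_{n+1}^⊥ p_n^⊥ π_{n+1} p_n^⊥ p_{n+1}^⊥` afterwards. -/
def compress (D : E →ₗ.[ℂ] E) :
    (n : ℕ) → (Pow B E (n + 1) →ₗ[ℂ] Pow B E (n + 1)) → (Pow B E (n + 1) →ₗ[ℂ] Pow B E (n + 1))
  | 0, T =>
    let p := woronowicz B D 0
    let p' := LinearMap.id - p
    p ∘ₗ T ∘ₗ p + p' ∘ₗ T ∘ₗ p'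
  | n + 1, T =>
    let q := double (woronowicz B D n)
    let q' := double (LinearMap.id - woronowicz B D n)
    let p := woronowicz B D (n + 1)
    let p' := LinearMap.id - p
    p ∘ₗ q ∘ₗ T ∘ₗ q ∘ₗ p + p' ∘ₗ q' ∘ₗ T ∘ₗ q' ∘ₗ p'

end Powers

/-! ### Sobolev subalgebras -/

namespace GradedBimodule

variable {A B E : Type*} [NonUnitalCStarAlgebra A]
  [NonUnitalCStarAlgebra B] [PartialOrder B] [StarOrderedRing B]
  [NormedAddCommGroup E] [NormedSpace ℂ E] [SMul B E] [CStarModule B E]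

/-- `D` is odd for the grading of `E`. -/
def IsOdd (M : GradedBimodule A B E) (D : E →ₗ.[ℂ] E) : Prop :=
  ∀ x : D.domain, ∃ h : M.gradE x ∈ D.domain, D ⟨M.gradE x, h⟩ = -M.gradE (D x)

/-- The map `θ_n`, with values in the operators on `E^(2^n)`. Here `θ_0` is the given action on `E`,
and `θ_{n+1}(a)` is the compression of
`π_{n+1}(a) = (θ_n(a), 0; [D, θ_n(a)], (-1)^{∂a} θ_n(a))`.
It is meaningful on `A_n` only. -/
def theta (M : GradedBimodule A B E) (D : E →ₗ.[ℂ] E) :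
    (n : ℕ) → A → (Pow B E n →ₗ[ℂ] Pow B E n)
  | 0, a => diag 0 (M.rep a)
  | n + 1, a =>
    compress D n
      (block (theta M D n a) 0
        (extension B (gradedCommutator (pdiag n D) (theta M D n a) (theta M D n (M.gradA a))))
        (theta M D n (M.gradA a)))

/-- The `n`-th Sobolev subalgebra `A_n`: `A_0 = A`, and `A_{n+1}` consists of the `a ∈ A_n` such
that `[D, θ_n(a)]` is adjointable. -/
def sobolev (M : GradedBimodule A B E) (D : E →ₗ.[ℂ] E) : ℕ → Set A
  | 0 => Set.univ
  | n + 1 => {a | a ∈ sobolev M D n ∧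
      MemEnd B (pdiag n D : Pow B E n →ₗ.[ℂ] Pow B E n)
        (gradedCommutator (pdiag n D) (M.theta D n a) (M.theta D n (M.gradA a)))}

/-- The iterated graded commutator `(ad D)^k(a)`, on its natural domain:
`(ad D)^(k+1)(a) = D (ad D)^k(a) - (-1)^{∂a + k} (ad D)^k(a) D`. -/
def adPow (M : GradedBimodule A B E) (D : E →ₗ.[ℂ] E) : ℕ → A → (E →ₗ.[ℂ] E)
  | 0, a => everywhere (M.rep a)
  | k + 1, a => pcomp D (M.adPow D k a) - (-1 : ℂ) ^ k • pcomp (M.adPow D k (M.gradA a)) D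

/-- `(ad D)^k(a) (D ± i)^{-k+1}` and `(ad D)^k(a*) (D ± i)^{-k+1}` are in `End*_B(E)`, for both
choices of the sign (where `k ≥ 1`). -/
def RelBounded (M : GradedBimodule A B E) (D : E →ₗ.[ℂ] E) (k : ℕ) (a : A) : Prop :=
  ∀ z ∈ ({Complex.I, -Complex.I} : Set ℂ), ∀ b ∈ ({a, star a} : Set A),
    MemEnd B D (pcomp (M.adPow D k b) (ppow (resolvent D z) (k - 1)))

end GradedBimodule

end SobolevChain

end

/-! Write R = (D+i)⁻¹ and S = (D-i)⁻¹. As D is selfadjoint and regular, both are everywhere defined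
and S = R*. Domain questions then become identities between everywhere defined operators: an
adjointable C extends the graded commutator [D,T] = DT - T'D exactly when TR = R(CR + T'DR + iTR)
(`CommEq`), and the bracket on the right is (D+i)T(D+i)⁻¹ (`next`).

The range of p_{n+1} is the graph of D. The map x ↦ (Rx, DRx) is an isometry of E^(2^n) onto it, and
x ↦ (-DRx, Rx) is one onto its complement. The matrix π_{n+1}(a) preserves the graph and acts there
as (D+i)θ_n(a)(D+i)⁻¹; its compression to the complement is the adjoint of the same expression for
the adjoint data (`adjPair_lowerNext`). The factors p_n keep one corner of θ_n(a) on each side. By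
induction θ_n(a) is carried by two copies of E: it is (D+i)ⁿ a (D+i)⁻ⁿ on one and, up to the
grading, the adjoint of (D+i)ⁿ a* (D+i)⁻ⁿ on the other (`ThetaForm`). The isometries intertwine D,
and conjugation by (D+i)ⁿ commutes with [D,·]. Hence a ∈ A_{n+1} if and only if, for c = a and c =
a*, the operator b = [D,c] and its conjugates (D+i)^k b (D+i)^(-k), k ≤ n, are adjointable
(`SmoothCommutator`, `mem_sobolev_succ_iff`).

To compare this with (R_k), let N_k extend (ad D)^(k+1)(c)(D+i)^(-k), let N'_k be its analogue for
the grading conjugate γ(c), and put L_k = (D+i)N_k(D+i)⁻¹. Then N_{k+1} = DR L_k + (-1)^k N'_k DR,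
so once N_k and N'_k are adjointable, adjointability of N_{k+1} and of L_k are equivalent
(`ExtendsAd.succ`, `ExtendsAd.exists_lift`). Induction converts iterated commutators into conjugates
of [D,c] and back. The recursion involves γ(c); since D is odd, the grading conjugates R to -S, so
the condition with -i for c supplies the one with +i for γ(c). This is where both signs in (R_k) are
used. -/

noncomputable section

namespace SobolevChain

open Complex (I)

/-! ### Values of partially defined operators -/

section Values

variable {X : Type*} [AddCommGroup X] [Module ℂ X]

/-- `x` lies in the domain of `f`, and `f x = y`. -/
def HasValue (f : X →ₗ.[ℂ] X) (x y : X) : Prop := ∃ h : x ∈ f.domain, f ⟨x, h⟩ = y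

lemma HasValue.mem {f : X →ₗ.[ℂ] X} {x y : X} (h : HasValue f x y) : x ∈ f.domain := h.1

lemma HasValue.unique {f : X →ₗ.[ℂ] X} {x y z : X} (h : HasValue f x y) (h' : HasValue f x z) :
    y = z := by
  obtain ⟨_, rfl⟩ := h
  obtain ⟨_, rfl⟩ := h'
  rfl

lemma hasValue_apply (f : X →ₗ.[ℂ] X) (x : f.domain) : HasValue f x (f x) := ⟨x.2, rfl⟩

lemma HasValue.add {f : X →ₗ.[ℂ] X} {x y x' y' : X} (h : HasValue f x y)
    (h' : HasValue f x' y') : HasValue f (x + x') (y + y') := by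
  obtain ⟨hx, rfl⟩ := h
  obtain ⟨hx', rfl⟩ := h'
  exact ⟨f.domain.add_mem hx hx', f.map_add ⟨x, hx⟩ ⟨x', hx'⟩⟩

lemma HasValue.smul {f : X →ₗ.[ℂ] X} {x y : X} (c : ℂ) (h : HasValue f x y) :
    HasValue f (c • x) (c • y) := by
  obtain ⟨hx, rfl⟩ := h
  exact ⟨f.domain.smul_mem c hx, f.map_smul c ⟨x, hx⟩⟩

lemma HasValue.sub {f : X →ₗ.[ℂ] X} {x y x' y' : X} (h : HasValue f x y)
    (h' : HasValue f x' y') : HasValue f (x - x') (y - y') := by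
  have := h.add (h'.smul (-1))
  rwa [neg_one_smul, neg_one_smul, ← sub_eq_add_neg, ← sub_eq_add_neg] at this

lemma HasValue.zero (f : X →ₗ.[ℂ] X) : HasValue f 0 0 := ⟨f.domain.zero_mem, f.map_zero⟩

@[simp] lemma hasValue_everywhere {T : X →ₗ[ℂ] X} {x y : X} :
    HasValue (everywhere T) x y ↔ T x = y :=
  ⟨fun h => h.2, fun h => ⟨trivial, h⟩⟩

lemma hasValue_pcomp {g f : X →ₗ.[ℂ] X} {x z : X} :
    HasValue (pcomp g f) x z ↔ ∃ y, HasValue f x y ∧ HasValue g y z := by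
  constructor
  · rintro ⟨⟨h, h'⟩, rfl⟩
    exact ⟨_, ⟨h, rfl⟩, ⟨h', rfl⟩⟩
  · rintro ⟨_, ⟨h, rfl⟩, ⟨h', rfl⟩⟩
    exact ⟨⟨h, h'⟩, rfl⟩

lemma hasValue_add {g f : X →ₗ.[ℂ] X} {x z : X} :
    HasValue (f + g) x z ↔ ∃ y y', HasValue f x y ∧ HasValue g x y' ∧ z = y + y' := by
  constructor
  · rintro ⟨⟨h, h'⟩, rfl⟩
    exact ⟨_, _, ⟨h, rfl⟩, ⟨h', rfl⟩, rfl⟩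
  · rintro ⟨_, _, ⟨h, rfl⟩, ⟨h', rfl⟩, rfl⟩
    exact ⟨⟨h, h'⟩, rfl⟩

lemma hasValue_sub {g f : X →ₗ.[ℂ] X} {x z : X} :
    HasValue (f - g) x z ↔ ∃ y y', HasValue f x y ∧ HasValue g x y' ∧ z = y - y' := by
  constructor
  · rintro ⟨⟨h, h'⟩, rfl⟩
    exact ⟨_, _, ⟨h, rfl⟩, ⟨h', rfl⟩, rfl⟩
  · rintro ⟨_, _, ⟨h, rfl⟩, ⟨h', rfl⟩, rfl⟩
    exact ⟨⟨h, h'⟩, rfl⟩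

lemma hasValue_smul {f : X →ₗ.[ℂ] X} {c : ℂ} {x z : X} :
    HasValue (c • f) x z ↔ ∃ y, HasValue f x y ∧ z = c • y := by
  constructor
  · rintro ⟨h, rfl⟩
    exact ⟨_, ⟨h, rfl⟩, rfl⟩
  · rintro ⟨_, ⟨h, rfl⟩, rfl⟩
    exact ⟨h, rfl⟩

/-- `LinearPMap.inverse` describes the inverse relation only for trivial kernel, hence the
hypothesis. -/
lemma hasValue_inverse {f : X →ₗ.[ℂ] X} (hf : ∀ x, HasValue f x 0 → x = 0) {x y : X} :
    HasValue f.inverse x y ↔ HasValue f y x := by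
  have hker : f.toFun.ker = ⊥ := by
    rw [LinearMap.ker_eq_bot']
    intro x hx
    exact Subtype.ext (hf x ⟨x.2, hx⟩)
  constructor
  · rintro ⟨h, rfl⟩
    have h' := h
    rw [LinearPMap.inverse_domain] at h'
    obtain ⟨z, hz⟩ := h'
    have : f.inverse ⟨x, h⟩ = z := LinearPMap.inverse_apply_eq hker hz
    rw [this]
    exact ⟨z.2, hz⟩
  · rintro ⟨h, rfl⟩
    have hm : f ⟨y, h⟩ ∈ f.inverse.domain := by
      rw [LinearPMap.inverse_domain]
      exact ⟨⟨y, h⟩, rfl⟩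
    exact ⟨hm, LinearPMap.inverse_apply_eq (y := ⟨_, hm⟩) hker rfl⟩

lemma total_eq {f : X →ₗ.[ℂ] X} {T : X →ₗ[ℂ] X} (h : ∀ x, HasValue f x (T x)) : total f = T := by
  have hd : f.domain = ⊤ := by
    rw [eq_top_iff]
    exact fun x _ => (h x).mem
  ext x
  rw [total, dif_pos hd]
  exact (h x).2

lemma hasValue_gradedCommutator {D : X →ₗ.[ℂ] X} {T T' : X →ₗ[ℂ] X} {x z : X} :
    HasValue (gradedCommutator D T T') x z ↔
      ∃ y w, HasValue D x y ∧ HasValue D (T x) w ∧ z = w - T' y := by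
  simp only [gradedCommutator, hasValue_sub, hasValue_pcomp, hasValue_everywhere]
  constructor
  · rintro ⟨w, y', ⟨_, rfl, hw⟩, ⟨y, hy, rfl⟩, rfl⟩
    exact ⟨y, w, hy, hw, rfl⟩
  · rintro ⟨y, w, hy, hw, rfl⟩
    exact ⟨w, _, ⟨_, rfl, hw⟩, ⟨y, hy, rfl⟩, rfl⟩

/-! ### Everywhere defined resolvents -/

/-- `R = (D + z)⁻¹`, defined everywhere. -/
structure IsResolvent (D : X →ₗ.[ℂ] X) (R : Module.End ℂ X) (z : ℂ) : Prop where
  value : ∀ x, HasValue D (R x) (x - z • R x)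
  left_inv : ∀ {x y}, HasValue D x y → R (y + z • x) = x

namespace IsResolvent

variable {D : X →ₗ.[ℂ] X} {R S : Module.End ℂ X} {z w : ℂ}

lemma injective (h : IsResolvent D R z) : Function.Injective R := by
  rw [← LinearMap.ker_eq_bot, LinearMap.ker_eq_bot']
  intro x hx
  have h1 := h.value x
  rw [hx, smul_zero, sub_zero] at h1
  exact h1.unique (HasValue.zero D)

lemma cancel_left (h : IsResolvent D R z) {S T : Module.End ℂ X} (e : R * S = R * T) : S = T :=
  LinearMap.ext fun x => h.injective (LinearMap.congr_fun e x)

lemma pow_injective (h : IsResolvent D R z) (n : ℕ) : Function.Injective (R ^ n) := by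
  rw [Module.End.coe_pow]
  exact h.injective.iterate n

lemma pow_cancel_left (h : IsResolvent D R z) {n : ℕ} {S T : Module.End ℂ X}
    (e : R ^ n * S = R ^ n * T) : S = T :=
  LinearMap.ext fun x => h.pow_injective n (LinearMap.congr_fun e x)

lemma exists_eq (h : IsResolvent D R z) {x : X} (hx : x ∈ D.domain) : ∃ y, R y = x :=
  ⟨_, h.left_inv ⟨hx, rfl⟩⟩

lemma hasValue_iff (h : IsResolvent D R z) {x y : X} :
    HasValue D x y ↔ ∃ u, x = R u ∧ y = u - z • R u := by
  constructor
  · intro hx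
    refine ⟨y + z • x, (h.left_inv hx).symm, ?_⟩
    rw [h.left_inv hx, add_sub_cancel_right]
  · rintro ⟨u, rfl, rfl⟩
    exact h.value u

/-- The resolvent identity: apply S = (D+w)⁻¹ to (D+w)Rx = x + (w-z)Rx. -/
lemma identity (h : IsResolvent D R z) (h' : IsResolvent D S w) :
    S + (w - z) • (S * R) = R := by
  ext x
  have := h'.left_inv (h.value x)
  simp only [map_add, map_sub, map_smul] at this
  refine Eq.trans ?_ this
  change S x + (w - z) • S (R x) = _
  rw [sub_smul]
  abel

lemma hasValue_resolvent (h : IsResolvent D R z) {x y : X} :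
    HasValue (resolvent D z) x y ↔ y = R x := by
  have key : ∀ {u v : X}, HasValue (D + everywhere (z • LinearMap.id)) u v ↔ u = R v := by
    intro u v
    rw [hasValue_add]
    simp only [hasValue_everywhere]
    constructor
    · rintro ⟨y, _, hy, rfl, rfl⟩
      exact (h.left_inv hy).symm
    · rintro rfl
      exact ⟨_, _, h.value v, rfl, by simp⟩
  rw [resolvent, hasValue_inverse, key]
  intro x hx
  rw [key.1 hx, map_zero]

lemma hasValue_ppow_resolvent (h : IsResolvent D R z) (k : ℕ) {x y : X} :
    HasValue (ppow (resolvent D z) k) x y ↔ y = (R ^ k) x := by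
  induction k generalizing y with
  | zero => simp [ppow, eq_comm]
  | succ k ih =>
    simp only [ppow, hasValue_pcomp, ih, h.hasValue_resolvent, exists_eq_left]
    rw [pow_succ', Module.End.mul_apply]

end IsResolvent

end Values

/-! ### Adjoint pairs of operators -/

section AdjointPairs

variable (B : Type*) [NonUnitalCStarAlgebra B] [PartialOrder B]
variable {X Y Z : Type*} [AddCommGroup X] [Module ℂ X] [Norm X] [SMul B X] [CStarModule B X]
variable [AddCommGroup Y] [Module ℂ Y] [Norm Y] [SMul B Y] [CStarModule B Y]
variable [AddCommGroup Z] [Module ℂ Z] [Norm Z] [SMul B Z] [CStarModule B Z]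

/-- `S` is the adjoint of `T`. -/
def AdjPair (T : X →ₗ[ℂ] Y) (S : Y →ₗ[ℂ] X) : Prop :=
  ∀ x y, inner B (T x) y = inner B x (S y)

variable {B}

lemma eq_of_inner_left {x y : X} (h : ∀ z : X, inner B z x = inner B z y) : x = y := by
  rw [← sub_eq_zero, ← CStarModule.inner_self (A := B), CStarModule.inner_sub_right, h, sub_self]

lemma eq_of_inner_right {x y : X} (h : ∀ z : X, inner B x z = inner B y z) : x = y := by
  rw [← sub_eq_zero, ← CStarModule.inner_self (A := B), CStarModule.inner_sub_left, h, sub_self]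

namespace AdjPair

variable {T T' : X →ₗ[ℂ] Y} {S S' : Y →ₗ[ℂ] X}

lemma symm (h : AdjPair B T S) : AdjPair B S T := fun x y => by
  rw [← CStarModule.star_inner, ← h, CStarModule.star_inner]

lemma right_unique (h : AdjPair B T S) (h' : AdjPair B T S') : S = S' :=
  LinearMap.ext fun y => eq_of_inner_left (B := B) fun x => by rw [← h, ← h']

lemma left_unique (h : AdjPair B T S) (h' : AdjPair B T' S) : T = T' :=
  h.symm.right_unique h'.symm

lemma add (h : AdjPair B T S) (h' : AdjPair B T' S') : AdjPair B (T + T') (S + S') :=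
  fun x y => by simp [h x y, h' x y]

lemma sub (h : AdjPair B T S) (h' : AdjPair B T' S') : AdjPair B (T - T') (S - S') :=
  fun x y => by simp [h x y, h' x y]

lemma neg (h : AdjPair B T S) : AdjPair B (-T) (-S) :=
  fun x y => by simp [h x y]

lemma smul (h : AdjPair B T S) (c : ℂ) : AdjPair B (c • T) (star c • S) :=
  fun x y => by simp [h x y]

lemma comp {U : Y →ₗ[ℂ] Z} {V : Z →ₗ[ℂ] Y} (h : AdjPair B U V) (h' : AdjPair B T S) :
    AdjPair B (U ∘ₗ T) (S ∘ₗ V) :=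
  fun x z => by rw [LinearMap.comp_apply, h, h', LinearMap.comp_apply]

lemma mul {T S T' S' : Module.End ℂ X} (h : AdjPair B T S) (h' : AdjPair B T' S') :
    AdjPair B (T * T') (S' * S) := h.comp h'

lemma one : AdjPair B (1 : Module.End ℂ X) 1 := fun _ _ => rfl

lemma pow {T S : Module.End ℂ X} (h : AdjPair B T S) (n : ℕ) : AdjPair B (T ^ n) (S ^ n) := by
  induction n with
  | zero => exact one
  | succ n ih => rw [pow_succ, pow_succ']; exact ih.mul h

end AdjPair

variable (B) in
/-- The adjointable operators, as a predicate on linear maps. -/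
def IsAdj (T : X →ₗ[ℂ] Y) : Prop := ∃ S : Y →ₗ[ℂ] X, AdjPair B T S

lemma isAdjointable_iff {T : X →ₗ[ℂ] X} : IsAdjointable B T ↔ IsAdj B T := by
  constructor
  · rintro ⟨S, h⟩
    refine ⟨{ toFun := S, map_add' := ?_, map_smul' := ?_ }, h⟩
    · intro x y
      refine eq_of_inner_left (B := B) fun z => ?_
      rw [CStarModule.inner_add_right, ← h, ← h, ← h, CStarModule.inner_add_right]
    · intro c x
      refine eq_of_inner_left (B := B) fun z => ?_
      rw [RingHom.id_apply, CStarModule.inner_smul_right_complex, ← h, ← h,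
        CStarModule.inner_smul_right_complex]
  · rintro ⟨S, h⟩
    exact ⟨S, h⟩

namespace IsAdj

lemma add {T T' : X →ₗ[ℂ] Y} (h : IsAdj B T) (h' : IsAdj B T') : IsAdj B (T + T') :=
  ⟨_, h.choose_spec.add h'.choose_spec⟩

lemma sub {T T' : X →ₗ[ℂ] Y} (h : IsAdj B T) (h' : IsAdj B T') : IsAdj B (T - T') :=
  ⟨_, h.choose_spec.sub h'.choose_spec⟩

lemma neg {T : X →ₗ[ℂ] Y} (h : IsAdj B T) : IsAdj B (-T) := ⟨_, h.choose_spec.neg⟩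

lemma smul {T : X →ₗ[ℂ] Y} (h : IsAdj B T) (c : ℂ) : IsAdj B (c • T) := ⟨_, h.choose_spec.smul c⟩

lemma comp {U : Y →ₗ[ℂ] Z} {T : X →ₗ[ℂ] Y} (h : IsAdj B U) (h' : IsAdj B T) :
    IsAdj B (U ∘ₗ T) := ⟨_, h.choose_spec.comp h'.choose_spec⟩

lemma mul {T T' : Module.End ℂ X} (h : IsAdj B T) (h' : IsAdj B T') : IsAdj B (T * T') :=
  h.comp h'

lemma one : IsAdj B (1 : Module.End ℂ X) := ⟨_, AdjPair.one⟩

lemma pow {T : Module.End ℂ X} (h : IsAdj B T) (n : ℕ) : IsAdj B (T ^ n) :=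
  ⟨_, h.choose_spec.pow n⟩

end IsAdj

end AdjointPairs

/-! ### Commutators with D expressed through the resolvents -/

section Resolvents

/-- `D (D + i)⁻¹ = 1 - i (D + i)⁻¹`, in terms of `R = (D + i)⁻¹`. -/
def bddPart {𝒜 : Type*} [Ring 𝒜] [Algebra ℂ 𝒜] (R : 𝒜) : 𝒜 := 1 - I • R

/-- `D (D - i)⁻¹ = 1 + i (D - i)⁻¹`, in terms of `R = (D - i)⁻¹`. -/
def bddPart' {𝒜 : Type*} [Ring 𝒜] [Algebra ℂ 𝒜] (R : 𝒜) : 𝒜 := 1 + I • R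

section Algebra

variable {𝒜 : Type*} [Ring 𝒜] [Algebra ℂ 𝒜] {R S T : 𝒜}

lemma commute_bddPart (h : Commute T R) : Commute T (bddPart R) :=
  (Commute.one_right T).sub_right (h.smul_right I)

lemma commute_bddPart' (h : Commute T R) : Commute T (bddPart' R) :=
  (Commute.one_right T).add_right (h.smul_right I)

/-- The algebraic relations between `R = (D + i)⁻¹` and `S = (D - i)⁻¹`. -/
structure ResolventRel (R S : 𝒜) : Prop where
  comm : Commute R S
  diff : R = S - (2 * I) • (S * R)

namespace ResolventRel

/-- SR is (1+D²)⁻¹ and the second term is D²(1+D²)⁻¹. This identity makes the maps onto the graph of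
D and its complement isometric. -/
lemma sum_eq_one (h : ResolventRel R S) : S * R + bddPart' S * bddPart R = 1 := by
  have h1 : S = R + (2 * I) • (S * R) := eq_add_of_sub_eq' (by rw [sub_eq_iff_eq_add', ← sub_eq_iff_eq_add]; exact h.diff.symm)
  have h2 : I • S - I • R = (-2 : ℂ) • (S * R) := by
    rw [← smul_sub, sub_eq_iff_eq_add'.2 h1, smul_smul]
    congr 1
    linear_combination 2 * Complex.I_mul_I
  simp only [bddPart, bddPart', add_mul, mul_sub, one_mul, mul_one, smul_mul_smul_comm,
    Complex.I_mul_I]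
  linear_combination (norm := module) h2

lemma mul_bddPart' (h : ResolventRel R S) : R * bddPart' S = S * bddPart R := by
  simp only [bddPart, bddPart', mul_add, mul_sub, mul_one, mul_smul_comm, h.comm.eq]
  nth_rw 1 [h.diff]
  module

/-- The Cayley transform `(D - i)(D + i)⁻¹`. -/
def cayley (R : 𝒜) : 𝒜 := 1 - (2 * I) • R

/-- The inverse `(D + i)(D - i)⁻¹` of the Cayley transform. -/
def cayley' (R : 𝒜) : 𝒜 := 1 + (2 * I) • R

lemma mul_cayley (h : ResolventRel R S) : S * cayley R = R := by
  rw [cayley, mul_sub, mul_one, mul_smul_comm, ← h.diff]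

lemma mul_cayley' (h : ResolventRel R S) : R * cayley' S = S := by
  rw [cayley', mul_add, mul_one, mul_smul_comm, h.comm.eq]
  nth_rw 1 [h.diff]
  module

end ResolventRel

end Algebra

/-- `T` maps `Dom D` to itself and `C` extends `D T - T' D`, in terms of `R = (D + i)⁻¹`. -/
def CommEq {𝒜 : Type*} [Ring 𝒜] [Algebra ℂ 𝒜] (R T T' C : 𝒜) : Prop :=
  T * R = R * (C * R + T' * bddPart R + I • (T * R))

section

variable {𝒜 : Type*} [Ring 𝒜] [Algebra ℂ 𝒜] {R S T T' C a a' b : 𝒜} {n : ℕ}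

lemma intertwine_aux (ha : a * R ^ n = R ^ n * T) (ha' : a' * R ^ n = R ^ n * T')
    (hb : b * R ^ n = R ^ n * C) :
    (b * R + a' * bddPart R + I • (a * R)) * R ^ n =
      R ^ n * (C * R + T' * bddPart R + I • (T * R)) := by
  have c1 : R * R ^ n = R ^ n * R := ((Commute.refl R).pow_right n).eq
  have c2 : bddPart R * R ^ n = R ^ n * bddPart R :=
    ((commute_bddPart (Commute.refl R)).pow_left n).eq.symm
  simp only [add_mul, mul_add, smul_mul_assoc, mul_smul_comm, mul_assoc, c1, c2]
  simp only [← mul_assoc, ha, ha', hb]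

/-- If T is the conjugate of a by (D+i)ⁿ, conjugating T once more by D+i gives the next conjugate of
a. -/
lemma intertwine_next (h : CommEq R T T' C) (ha : a * R ^ n = R ^ n * T) :
    a * R ^ (n + 1) = R ^ (n + 1) * (C * R + T' * bddPart R + I • (T * R)) := by
  rw [pow_succ, ← mul_assoc, ha, mul_assoc, mul_assoc]
  exact congrArg (fun x => R ^ n * x) h

/-- `CommEq` writes TR as R applied to the bracket, so DTR is DR = `bddPart R` applied to it;
subtracting T'DR leaves CR. -/
lemma CommEq.mul_eq (h : CommEq R T T' C) :
    C * R = bddPart R * (C * R + T' * bddPart R + I • (T * R)) - T' * bddPart R := by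
  have h' : T * R = R * (C * R + T' * bddPart R + I • (T * R)) := h
  set U := C * R + T' * bddPart R + I • (T * R) with hU
  rw [bddPart, sub_mul, one_mul, smul_mul_assoc, ← h', hU, bddPart]
  abel

/-- Conjugation of a commutator by an involution that maps `(D + i)⁻¹` to `-(D - i)⁻¹`. -/
lemma CommEq.conj (hRS : ResolventRel R S) {g : 𝒜} (hg : g * g = 1) (hgR : g * R * g = -S)
    (h : CommEq R T T' C) : CommEq R (g * T * g) (g * T' * g) (-(g * C * g)) := by
  -- Conjugating the hypothesis yields the analogue of `CommEq` for D - i; the sign of C flips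
  -- because D anticommutes with g. Multiplying by Cayley transforms then returns from S to R.
  have key : g * T * g * S = S * (-(g * C * g) * S + g * T' * g * bddPart' S - I • (g * T * g * S)) := by
    have e := congrArg (fun x => g * x * g) h
    have ins : ∀ x y : 𝒜, g * (x * y) * g = (g * x * g) * (g * y * g) := fun x y => by
      calc g * (x * y) * g = g * x * 1 * y * g := by simp only [mul_one, mul_assoc]
        _ = _ := by rw [← hg]; simp only [mul_assoc]
    have hG : g * bddPart R * g = bddPart' S := by
      rw [bddPart, bddPart', mul_sub, sub_mul, mul_one, hg, mul_smul_comm, smul_mul_assoc, hgR]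
      module
    simp only [ins, mul_add, add_mul, mul_smul_comm, smul_mul_assoc, hgR, hG] at e
    simp only [mul_neg, neg_mul, mul_add, mul_sub, mul_smul_comm] at e ⊢
    rw [neg_eq_iff_eq_neg] at e
    refine e.trans ?_
    module
  have hW : S * ResolventRel.cayley R = R := hRS.mul_cayley
  have hGW : bddPart' S * ResolventRel.cayley R = bddPart R := by
    rw [bddPart', bddPart, add_mul, one_mul, smul_mul_assoc, hW, ResolventRel.cayley]
    module
  have key2 : g * T * g * R =
      S * (-(g * C * g) * R + g * T' * g * bddPart R - I • (g * T * g * R)) := by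
    have e := congrArg (· * ResolventRel.cayley R) key
    simpa only [mul_assoc, hW, hGW, add_mul, sub_mul, smul_mul_assoc] using e
  rw [CommEq]
  set V := -(g * C * g) * R + g * T' * g * bddPart R - I • (g * T * g * R) with hV
  have e3 : -(g * C * g) * R + g * T' * g * bddPart R + I • (g * T * g * R) =
      ResolventRel.cayley' S * V := by
    rw [ResolventRel.cayley', add_mul, one_mul, smul_mul_assoc, ← key2, hV]
    module
  rw [e3, ← mul_assoc, hRS.mul_cayley', ← key2]

end

lemma IsResolvent.resolventRel {X : Type*} [AddCommGroup X] [Module ℂ X] {D : X →ₗ.[ℂ] X}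
    {R S : Module.End ℂ X} (h : IsResolvent D R I) (h' : IsResolvent D S (-I)) :
    ResolventRel R S := by
  have e1 := h.identity h'
  have e2 := h'.identity h
  have e3 : R * S = S * R := by
    have : (2 * I) • (R * S) = (2 * I) • (S * R) := by
      have e1' : R = S - (2 * I) • (S * R) := by
        rw [← e1]
        conv_rhs => rw [e1]
        module
      have e2' : S = R + (2 * I) • (R * S) := by
        conv_lhs => rw [← e2]
        module
      have : R + (2 * I) • (R * S) = R + (2 * I) • (S * R) := by
        rw [← e2', ← sub_eq_iff_eq_add, ← e1']
      exact add_left_cancel this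
    exact smul_right_injective _ (by simp : (2 * I : ℂ) ≠ 0) this
  refine ⟨e3, ?_⟩
  conv_lhs => rw [← e1]
  module

variable (B : Type*) [NonUnitalCStarAlgebra B] [PartialOrder B]
variable {X : Type*} [AddCommGroup X] [Module ℂ X] [Norm X] [SMul B X] [CStarModule B X]

/-- `R = (D + i)⁻¹` and `S = (D - i)⁻¹` are everywhere defined and adjoint to each other. -/
structure ResolventPair (D : X →ₗ.[ℂ] X) (R S : Module.End ℂ X) : Prop where
  res : IsResolvent D R I
  res' : IsResolvent D S (-I)
  adj : AdjPair B R S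

variable {B}
variable {D : X →ₗ.[ℂ] X} {R S : Module.End ℂ X}

/-- The graded commutator `[D, T]` is an adjointable operator with extension `C` if and only if
`C` is adjointable and satisfies `CommEq`. -/
lemma IsResolvent.extends_gradedCommutator_iff (h : IsResolvent D R I) {T T' C : Module.End ℂ X} :
    (D.domain ≤ (gradedCommutator D T T').domain ∧
      IsAdjointableExtension B (gradedCommutator D T T') C) ↔ IsAdj B C ∧ CommEq R T T' C := by
  constructor
  · rintro ⟨hdom, hadj, hC⟩
    refine ⟨isAdjointable_iff.1 hadj, LinearMap.ext fun x => ?_⟩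
    have hx := hdom (h.value x).mem
    obtain ⟨y, w, hy, hw, e⟩ := hasValue_gradedCommutator.1 (hasValue_apply _ ⟨R x, hx⟩)
    have hCx := hC ⟨R x, hx⟩
    rw [e, hy.unique (h.value x)] at hCx
    have := h.left_inv hw
    simp only [Module.End.mul_apply, LinearMap.add_apply, LinearMap.smul_apply, bddPart,
      LinearMap.sub_apply, Module.End.one_apply]
    conv_lhs => rw [← this]
    rw [show C (R x) = _ from hCx, sub_add_cancel]
  · rintro ⟨hadj, hC⟩
    have hC' : ∀ u, T (R u) = R (C (R u) + T' (u - I • R u) + I • T (R u)) :=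
      LinearMap.congr_fun hC
    refine ⟨?_, isAdjointable_iff.2 hadj, ?_⟩
    · intro x hx
      obtain ⟨u, rfl⟩ := h.exists_eq hx
      have hw := h.value (C (R u) + T' (u - I • R u) + I • T (R u))
      rw [← hC' u] at hw
      exact (hasValue_gradedCommutator.2 ⟨_, _, h.value u, hw, rfl⟩).mem
    · intro x
      obtain ⟨y, w, hy, hw, e⟩ := hasValue_gradedCommutator.1 (hasValue_apply _ x)
      obtain ⟨u, hu, rfl⟩ := h.hasValue_iff.1 hy
      rw [e, hu]
      rw [hu] at hw
      have hw' := h.value (C (R u) + T' (u - I • R u) + I • T (R u))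
      rw [← hC' u] at hw'
      rw [hw.unique hw']
      abel

lemma IsResolvent.memEnd_gradedCommutator_iff (h : IsResolvent D R I) {T T' : Module.End ℂ X} :
    MemEnd B D (gradedCommutator D T T') ↔ ∃ C, IsAdj B C ∧ CommEq R T T' C := by
  constructor
  · rintro ⟨hd, C, hC⟩
    exact ⟨C, h.extends_gradedCommutator_iff.1 ⟨hd, hC⟩⟩
  · rintro ⟨C, hC⟩
    have := h.extends_gradedCommutator_iff.2 hC
    exact ⟨this.1, C, this.2⟩

namespace ResolventPair

variable (h : ResolventPair B D R S)
include h

lemma rel : ResolventRel R S := h.res.resolventRel h.res'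

lemma isAdj : IsAdj B R := ⟨S, h.adj⟩

lemma isAdj' : IsAdj B S := ⟨R, h.adj.symm⟩

lemma adj_bddPart : AdjPair B (bddPart R) (bddPart' S) := by
  have := (AdjPair.one (B := B) (X := X)).sub (h.adj.smul I)
  simpa [bddPart, bddPart'] using this

lemma isAdj_bddPart : IsAdj B (bddPart R) := ⟨_, h.adj_bddPart⟩

lemma isAdj_cayley' : IsAdj B (ResolventRel.cayley' S) :=
  IsAdj.one.add (h.isAdj'.smul _)

lemma isAdj_cayley : IsAdj B (ResolventRel.cayley R) :=
  IsAdj.one.sub (h.isAdj.smul _)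

/-- The range of `R` is dense as far as adjointable operators are concerned. -/
lemma cancel_right {T T' : Module.End ℂ X} (hT : IsAdj B T) (hT' : IsAdj B T')
    (e : T * R = T' * R) : T = T' := by
  obtain ⟨U, hU⟩ := hT
  obtain ⟨U', hU'⟩ := hT'
  have h1 : AdjPair B (T * R) (S * U) := hU.mul h.adj
  have h2 : AdjPair B (T * R) (S * U') := e ▸ hU'.mul h.adj
  have := h.res'.cancel_left (h1.right_unique h2)
  subst this
  exact hU.left_unique hU'

lemma isAdj_next {T T' C : Module.End ℂ X} (hT : IsAdj B T) (hT' : IsAdj B T') (hC : IsAdj B C) :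
    IsAdj B (C * R + T' * bddPart R + I • (T * R)) :=
  ((hC.mul h.isAdj).add (hT'.mul h.isAdj_bddPart)).add ((hT.mul h.isAdj).smul _)

/-- Conjugation by (D+i)ⁿ commutes with [D,·], because D commutes with D+i; injectivity of Rⁿ
removes the power on the left. -/
lemma commEq_of_intertwine {n : ℕ} {a a' b T T' C : Module.End ℂ X}
    (ha : a * R ^ n = R ^ n * T) (ha' : a' * R ^ n = R ^ n * T')
    (hb : b * R ^ n = R ^ n * C) (hab : CommEq R a a' b) : CommEq R T T' C := by
  refine h.res.pow_cancel_left (n := n) ?_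
  calc R ^ n * (T * R) = a * R * R ^ n := by
        rw [← mul_assoc, ← ha, mul_assoc, mul_assoc, ((Commute.refl R).pow_left n).eq]
    _ = R * ((b * R + a' * bddPart R + I • (a * R)) * R ^ n) :=
      (congrArg (· * R ^ n) hab).trans (mul_assoc _ _ _)
    _ = _ := by
      rw [intertwine_aux ha ha' hb, ← mul_assoc, ← mul_assoc, ((Commute.refl R).pow_left n).eq]

/-- Converse direction: a known commutator of the conjugate T must be the conjugate of b. The
comparison takes place after multiplication by R on the right, which is cancelled using
adjointability of b and C. -/
lemma intertwine_of_commEq {n : ℕ} {a a' b T T' C : Module.End ℂ X} (hbadj : IsAdj B b)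
    (hCadj : IsAdj B C)
    (ha : a * R ^ n = R ^ n * T) (ha' : a' * R ^ n = R ^ n * T')
    (hab : CommEq R a a' b) (hC : CommEq R T T' C) : b * R ^ n = R ^ n * C := by
  have c1 : R * R ^ n = R ^ n * R := ((Commute.refl R).pow_right n).eq
  have c2 : bddPart R * R ^ n = R ^ n * bddPart R :=
    ((commute_bddPart (Commute.refl R)).pow_left n).eq.symm
  have hR : IsAdj B (R ^ n) := h.isAdj.pow n
  refine h.cancel_right (hbadj.mul hR) (hR.mul hCadj) (h.res.cancel_left ?_)
  have e1 : R * ((b * R + a' * bddPart R + I • (a * R)) * R ^ n) =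
      R * (R ^ n * (C * R + T' * bddPart R + I • (T * R))) := by
    calc R * ((b * R + a' * bddPart R + I • (a * R)) * R ^ n) = a * R * R ^ n :=
          ((congrArg (· * R ^ n) hab).trans (mul_assoc _ _ _)).symm
      _ = R ^ n * (T * R) := by rw [mul_assoc, c1, ← mul_assoc, ha, mul_assoc]
      _ = R ^ n * (R * (C * R + T' * bddPart R + I • (T * R))) := congrArg (R ^ n * ·) hC
      _ = _ := by rw [← mul_assoc, ← c1, mul_assoc]
  have e2 := h.res.cancel_left e1
  simp only [add_mul, mul_add, smul_mul_assoc, mul_smul_comm, mul_assoc, c1, c2] at e2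
  simp only [← mul_assoc, ha, ha'] at e2
  rw [add_left_inj, add_left_inj] at e2
  rw [e2]

/-- The adjoint of a commutator. -/
lemma commEq_adjoint {T T' C Ts Ts' Cs : Module.End ℂ X} (hT : AdjPair B T Ts)
    (hT' : AdjPair B T' Ts') (hC : AdjPair B C Cs) (e : CommEq R T T' C) :
    CommEq R Ts' Ts (-Cs) := by
  have hU := ((hC.mul h.adj).add (hT'.mul h.adj_bddPart)).add ((hT.mul h.adj).smul I)
  -- Formally (DT - T'D)* = T*D - DT'*, so T and T' trade roles and C* changes sign. To avoid
  -- domains, `e1` and `e2` take adjoints of the bounded identities for TR and CR; V is the adjoint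
  -- of `next R T T' C`.
  have e1 : S * Ts = (S * Cs + bddPart' S * Ts' + star I • (S * Ts)) * S := by
    have hl := hT.mul h.adj
    rw [e] at hl
    exact hl.right_unique (h.adj.mul hU)
  have e2 : S * Cs = (S * Cs + bddPart' S * Ts' + star I • (S * Ts)) * bddPart' S
      - bddPart' S * Ts' := by
    have hl := hC.mul h.adj
    rw [e.mul_eq] at hl
    exact (hC.mul h.adj).right_unique (e.mul_eq ▸ (h.adj_bddPart.mul hU).sub
      (hT'.mul h.adj_bddPart))
  set V := S * Cs + bddPart' S * Ts' + star I • (S * Ts) with hV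
  refine h.res'.cancel_left (S := Ts' * R) ?_
  have e3 : S * (-Cs * R + Ts * bddPart R + I • (Ts' * R)) =
      ResolventRel.cayley' S * (Ts' * R) := by
    calc S * (-Cs * R + Ts * bddPart R + I • (Ts' * R))
        = -(S * Cs) * R + S * Ts * bddPart R + I • (S * (Ts' * R)) := by
          simp only [mul_add, mul_smul_comm, neg_mul, mul_neg, mul_assoc]
      _ = -(V * (bddPart' S * R) - bddPart' S * (Ts' * R)) + V * (S * bddPart R)
            + I • (S * (Ts' * R)) := by
          rw [e1, e2]
          simp only [sub_mul, neg_mul, mul_assoc]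
      _ = bddPart' S * (Ts' * R) + I • (S * (Ts' * R)) := by
          rw [← (commute_bddPart' h.rel.comm).eq, h.rel.mul_bddPart']
          abel
      _ = _ := by
          rw [bddPart', ResolventRel.cayley', add_mul, add_mul, smul_mul_assoc, smul_mul_assoc]
          module
  rw [← mul_assoc S R, ← h.rel.comm.eq, mul_assoc R S, e3, ← mul_assoc R, h.rel.mul_cayley']

end ResolventPair

end Resolvents

/-! ### Resolvents of a selfadjoint regular operator -/

section Existence

variable {B E : Type*} [NonUnitalCStarAlgebra B] [PartialOrder B]
  [NormedAddCommGroup E] [NormedSpace ℂ E] [SMul B E] [CStarModule B E]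
  {D : E →ₗ.[ℂ] E}

lemma IsSelfAdjointRegular.inner_eq (hD : IsSelfAdjointRegular B D) {x y x' y' : E}
    (h : HasValue D x y) (h' : HasValue D x' y') : inner B y x' = inner B x y' := by
  obtain ⟨hx, rfl⟩ := h
  obtain ⟨hx', rfl⟩ := h'
  exact hD.symmetric ⟨x, hx⟩ ⟨x', hx'⟩

variable [StarOrderedRing B]

/-- For z = ±i the cross terms in ⟨(D+z)x, (D+z)x⟩ cancel by symmetry, leaving ⟨Dx,Dx⟩ + ⟨x,x⟩. -/
lemma IsSelfAdjointRegular.norm_le (hD : IsSelfAdjointRegular B D) {x y : E}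
    (h : HasValue D x y) {z : ℂ} (hz : z = I ∨ z = -I) : ‖x‖ ≤ ‖y + z • x‖ := by
  have e : inner B (y + z • x) (y + z • x) = inner B y y + inner B x x := by
    have hs := hD.inner_eq h h
    simp only [CStarModule.inner_add_left, CStarModule.inner_add_right,
      CStarModule.inner_smul_left_complex, CStarModule.inner_smul_right_complex, hs]
    rcases hz with rfl | rfl <;> simp [smul_smul]
  have hle : inner B x x ≤ inner B (y + z • x) (y + z • x) := by
    rw [e]
    exact le_add_of_nonneg_left CStarModule.inner_self_nonneg
  have := CStarAlgebra.norm_le_norm_of_nonneg_of_le CStarModule.inner_self_nonneg hle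
  rw [← CStarModule.norm_sq_eq B, ← CStarModule.norm_sq_eq B] at this
  exact le_of_sq_le_sq this (norm_nonneg _)

/-- The range of D+z is dense since it contains that of 1+D² = (D+z)(D-z), and it is closed because
D is closed and D+z is bounded below. -/
lemma IsSelfAdjointRegular.surjective [CompleteSpace E] (hD : IsSelfAdjointRegular B D) {z : ℂ}
    (hz : z = I ∨ z = -I) (v : E) : ∃ x, HasValue D x (v - z • x) := by
  have hclosed : v ∈ closure {u : E | ∃ x y, HasValue D x y ∧ y + z • x = u} := by
    refine closure_mono ?_ (hD.dense_range v)
    rintro _ ⟨x, rfl⟩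
    obtain ⟨a, b, ha, hb, e⟩ := hasValue_add.1 (hasValue_apply (onePlusSq D) x)
    obtain ⟨y, hy, hw⟩ := hasValue_pcomp.1 hb
    -- The witness is (D-z)x; since z² = -1, applying D+z gives (1+D²)x.
    refine ⟨y - z • (x : E), b - z • y, hw.sub (hy.smul z), ?_⟩
    rw [hasValue_everywhere] at ha
    have hzz : z * z = -1 := by rcases hz with rfl | rfl <;> simp
    change _ = onePlusSq D x
    rw [e, ← ha, smul_sub, smul_smul, hzz, LinearMap.id_apply]
    module
  obtain ⟨u, hu, hlim⟩ := mem_closure_iff_seq_limit.1 hclosed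
  choose x y hxy e using hu
  have hc : CauchySeq x := by
    have huc := hlim.cauchySeq
    rw [Metric.cauchySeq_iff] at huc ⊢
    intro ε hε
    obtain ⟨N, hN⟩ := huc ε hε
    refine ⟨N, fun m hm n hn => lt_of_le_of_lt ?_ (hN m hm n hn)⟩
    rw [dist_eq_norm, dist_eq_norm, ← e m, ← e n]
    rw [show y m + z • x m - (y n + z • x n) = y m - y n + z • (x m - x n) by module]
    exact hD.norm_le ((hxy m).sub (hxy n)) hz
  obtain ⟨x₀, hx₀⟩ := cauchySeq_tendsto_of_complete hc
  refine ⟨x₀, ?_⟩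
  have hy : Filter.Tendsto y Filter.atTop (nhds (v - z • x₀)) := by
    have : y = fun n => u n - z • x n := funext fun n => by rw [← e n, add_sub_cancel_right]
    rw [this]
    exact hlim.sub (hx₀.const_smul z)
  have hmem : (x₀, v - z • x₀) ∈ (D.graph : Set (E × E)) := by
    refine IsClosed.mem_of_tendsto hD.isClosed (hx₀.prodMk_nhds hy) (.of_forall fun n => ?_)
    obtain ⟨h, h'⟩ := hxy n
    exact (LinearPMap.mem_graph_iff D).2 ⟨⟨x n, h⟩, rfl, h'⟩
  obtain ⟨⟨w, hw⟩, h1, h2⟩ := (LinearPMap.mem_graph_iff D).1 hmem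
  obtain rfl : w = x₀ := h1
  exact ⟨hw, h2⟩

lemma IsSelfAdjointRegular.eq_of_value (hD : IsSelfAdjointRegular B D) {z : ℂ}
    (hz : z = I ∨ z = -I) {v x x' : E} (h : HasValue D x (v - z • x))
    (h' : HasValue D x' (v - z • x')) : x = x' := by
  have := hD.norm_le (h.sub h') hz
  rw [show v - z • x - (v - z • x') + z • (x - x') = 0 by module, norm_zero] at this
  exact sub_eq_zero.1 (norm_le_zero_iff.1 this)

lemma IsSelfAdjointRegular.exists_isResolvent [CompleteSpace E] (hD : IsSelfAdjointRegular B D)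
    {z : ℂ} (hz : z = I ∨ z = -I) : ∃ R : Module.End ℂ E, IsResolvent D R z := by
  choose R hR using hD.surjective hz
  refine ⟨{ toFun := R, map_add' := fun v w => ?_, map_smul' := fun c v => ?_ }, hR, ?_⟩
  · refine hD.eq_of_value hz (hR _) ?_
    convert (hR v).add (hR w) using 1
    module
  · refine hD.eq_of_value hz (hR _) ?_
    rw [RingHom.id_apply, show c • v - z • c • R v = c • (v - z • R v) by module]
    exact (hR v).smul c
  · intro x y hxy
    refine hD.eq_of_value hz (hR _) ?_
    rwa [add_sub_cancel_right]

lemma IsSelfAdjointRegular.exists_resolventPair [CompleteSpace E]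
    (hD : IsSelfAdjointRegular B D) : ∃ R S : Module.End ℂ E, ResolventPair B D R S := by
  obtain ⟨R, hR⟩ := hD.exists_isResolvent (Or.inl rfl)
  obtain ⟨S, hS⟩ := hD.exists_isResolvent (Or.inr rfl)
  refine ⟨R, S, hR, hS, fun v w => ?_⟩
  have h := hD.inner_eq (hR.value v) (hS.value w)
  simp only [CStarModule.inner_sub_left, CStarModule.inner_sub_right,
    CStarModule.inner_smul_left_complex, CStarModule.inner_smul_right_complex] at h
  rw [sub_eq_iff_eq_add] at h
  rw [h]
  simp

end Existence

/-! ### Diagonal action on E^(2^n) -/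

section Diagonal

variable {B E : Type*} [NormedAddCommGroup E] [NormedSpace ℂ E] {D : E →ₗ.[ℂ] E}

lemma hasValue_pdiag {n : ℕ} {x y : Pow B E n} :
    HasValue (pdiag n D) x y ↔ ∀ i, HasValue D (x i) (y i) := by
  constructor
  · rintro ⟨h, rfl⟩ i
    exact ⟨h i, rfl⟩
  · intro h
    exact ⟨fun i => (h i).mem, funext fun i => (h i).2⟩

lemma IsResolvent.diag {R : Module.End ℂ E} {z : ℂ} (h : IsResolvent D R z) (n : ℕ) :
    IsResolvent (pdiag n D : Pow B E n →ₗ.[ℂ] Pow B E n) (SobolevChain.diag n R) z where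
  value x := hasValue_pdiag.2 fun i => h.value (x i)
  left_inv hx := funext fun i => h.left_inv (hasValue_pdiag.1 hx i)

section

variable [NonUnitalCStarAlgebra B] [PartialOrder B] [StarOrderedRing B] [SMul B E]
  [CStarModule B E]

lemma AdjPair.diag {T S : Module.End ℂ E} (h : AdjPair B T S) (n : ℕ) :
    AdjPair B (SobolevChain.diag n T : Pow B E n →ₗ[ℂ] Pow B E n) (SobolevChain.diag n S) :=
  fun x y => Finset.sum_congr rfl fun i _ => h (x i) (y i)

lemma ResolventPair.diag {R S : Module.End ℂ E} (h : ResolventPair B D R S) (n : ℕ) :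
    ResolventPair B (pdiag n D : Pow B E n →ₗ.[ℂ] Pow B E n) (SobolevChain.diag n R)
      (SobolevChain.diag n S) :=
  ⟨h.res.diag n, h.res'.diag n, h.adj.diag n⟩

end

end Diagonal

/-! ### The Woronowicz projection -/

section InvOnePlusSq

variable {X : Type*} [AddCommGroup X] [Module ℂ X] {D : X →ₗ.[ℂ] X} {R S : Module.End ℂ X}

lemma ResolventRel.sum_eq_one' {𝒜 : Type*} [Ring 𝒜] [Algebra ℂ 𝒜] {R S : 𝒜}
    (h : ResolventRel R S) : R * S + bddPart R * bddPart' S = 1 := by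
  have c1 : Commute (bddPart R) (bddPart' S) :=
    commute_bddPart' (commute_bddPart h.comm.symm).symm
  rw [h.comm.eq, c1.eq, h.sum_eq_one]

lemma ResolventRel.mul_bddPart'_eq {𝒜 : Type*} [Ring 𝒜] [Algebra ℂ 𝒜] {R S : 𝒜}
    (h : ResolventRel R S) : R * bddPart' S = bddPart R * S := by
  rw [h.mul_bddPart', (commute_bddPart h.comm.symm).eq]

lemma IsResolvent.value_bddPart (h : IsResolvent D R I) (x : X) :
    HasValue D (R x) (bddPart R x) := h.value x

lemma ResolventRel.apply_comm (hrel : ResolventRel R S) (x : X) : R (S x) = S (R x) :=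
  LinearMap.congr_fun hrel.comm x

lemma ResolventRel.apply_mul_bddPart'_eq (hrel : ResolventRel R S) (x : X) :
    R (bddPart' S x) = bddPart R (S x) :=
  LinearMap.congr_fun hrel.mul_bddPart'_eq x

lemma ResolventRel.apply_sum_eq_one' (hrel : ResolventRel R S) (x : X) :
    R (S x) + bddPart R (bddPart' S x) = x :=
  LinearMap.congr_fun hrel.sum_eq_one' x

/-- This rests on the factorization 1+D² = (D+i)(D-i), domains included. -/
lemma hasValue_onePlusSq (h : IsResolvent D R I) (h' : IsResolvent D S (-I)) {x y : X} :
    HasValue (onePlusSq D) x y ↔ x = R (S y) := by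
  have hrel := h.resolventRel h'
  simp only [onePlusSq, hasValue_add, hasValue_everywhere, hasValue_pcomp]
  constructor
  · rintro ⟨_, b, rfl, ⟨w, hw, hb⟩, rfl⟩
    have h1 := h.left_inv (hb.sub (hw.smul I))
    have h2 := h'.left_inv hw
    have h3 : b - I • w + I • (w - I • x) = x + b := by
      rw [smul_sub, smul_smul, Complex.I_mul_I]
      module
    rw [h3] at h1
    rw [LinearMap.id_apply, hrel.apply_comm, h1, sub_eq_add_neg, ← neg_smul, h2]
  · rintro rfl
    refine ⟨_, _, rfl, ⟨_, h.value_bddPart (S y), ?_⟩, (hrel.apply_sum_eq_one' y).symm⟩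
    rw [← hrel.apply_mul_bddPart'_eq]
    exact h.value_bddPart _

lemma hasValue_invOnePlusSq (h : IsResolvent D R I) (h' : IsResolvent D S (-I)) {x y : X} :
    HasValue (invOnePlusSq D) x y ↔ y = R (S x) := by
  rw [invOnePlusSq, hasValue_inverse, hasValue_onePlusSq h h']
  intro x hx
  rw [(hasValue_onePlusSq h h').1 hx, map_zero, map_zero]

lemma total_invOnePlusSq (h : IsResolvent D R I) (h' : IsResolvent D S (-I)) :
    total (invOnePlusSq D) = R * S :=
  total_eq fun _ => (hasValue_invOnePlusSq h h').2 rfl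

lemma total_pcomp_invOnePlusSq (h : IsResolvent D R I) (h' : IsResolvent D S (-I)) :
    total (pcomp D (invOnePlusSq D)) = bddPart R * S :=
  total_eq fun x => hasValue_pcomp.2
    ⟨_, (hasValue_invOnePlusSq h h').2 rfl, h.value_bddPart (S x)⟩

lemma total_pcomp_sq_invOnePlusSq (h : IsResolvent D R I) (h' : IsResolvent D S (-I)) :
    total (pcomp (pcomp D D) (invOnePlusSq D)) = bddPart R * bddPart' S :=
  total_eq fun x => hasValue_pcomp.2
    ⟨_, (hasValue_invOnePlusSq h h').2 rfl, hasValue_pcomp.2 ⟨_, h.value_bddPart (S x), by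
      rw [← (h.resolventRel h').apply_mul_bddPart'_eq]
      exact h.value_bddPart (bddPart' S x)⟩⟩

end InvOnePlusSq

/-! ### The isometries onto the graph of `D` and its complement -/

section Columns

variable {B E : Type*} [NormedAddCommGroup E] [NormedSpace ℂ E] {n : ℕ}

/-- The isometry `x ↦ (R x, D R x)` onto the graph of `D`, where `R = (D + i)⁻¹`. -/
def graphIso (n : ℕ) (R : Module.End ℂ E) : Pow B E n →ₗ[ℂ] Pow B E (n + 1) where
  toFun x := pair (diag n R x) (diag n (bddPart R) x)
  map_add' x y := by
    rw [map_add, map_add]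
    funext i
    cases i <;> rfl
  map_smul' c x := by
    rw [map_smul, map_smul]
    funext i
    cases i <;> rfl

/-- The isometry `x ↦ (-D R x, R x)` onto the complement of the graph of `D`, where
`R = (D + i)⁻¹`. -/
def graphIso' (n : ℕ) (R : Module.End ℂ E) : Pow B E n →ₗ[ℂ] Pow B E (n + 1) where
  toFun x := pair (-diag n (bddPart R) x) (diag n R x)
  map_add' x y := by
    rw [map_add, map_add, neg_add]
    funext i
    cases i <;> rfl
  map_smul' c x := by
    rw [map_smul, map_smul, ← smul_neg]
    funext i
    cases i <;> rfl

/-- The adjoint of `graphIso n R`, in terms of the adjoint `S` of `R`. -/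
def graphProj (n : ℕ) (S : Module.End ℂ E) : Pow B E (n + 1) →ₗ[ℂ] Pow B E n :=
  diag n S ∘ₗ fstL n + diag n (bddPart' S) ∘ₗ sndL n

/-- The adjoint of `graphIso' n R`, in terms of the adjoint `S` of `R`. -/
def graphProj' (n : ℕ) (S : Module.End ℂ E) : Pow B E (n + 1) →ₗ[ℂ] Pow B E n :=
  diag n S ∘ₗ sndL n - diag n (bddPart' S) ∘ₗ fstL n

@[simp] lemma fstL_pair (x y : Pow B E n) : fstL n (pair x y) = x := rfl

@[simp] lemma sndL_pair (x y : Pow B E n) : sndL n (pair x y) = y := rfl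

lemma pair_ext {x y : Pow B E (n + 1)} (h : fstL n x = fstL n y) (h' : sndL n x = sndL n y) :
    x = y := by
  funext i
  cases i with
  | inl i => exact congrFun h i
  | inr i => exact congrFun h' i

lemma graphIso_apply (R : Module.End ℂ E) (x : Pow B E n) :
    graphIso n R x = pair (diag n R x) (diag n (bddPart R) x) := rfl

lemma graphIso'_apply (R : Module.End ℂ E) (x : Pow B E n) :
    graphIso' n R x = pair (-diag n (bddPart R) x) (diag n R x) := rfl

lemma graphProj_apply (S : Module.End ℂ E) (x : Pow B E (n + 1)) :
    graphProj n S x = diag n S (fstL n x) + diag n (bddPart' S) (sndL n x) := rfl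

lemma graphProj'_apply (S : Module.End ℂ E) (x : Pow B E (n + 1)) :
    graphProj' n S x = diag n S (sndL n x) - diag n (bddPart' S) (fstL n x) := rfl

lemma block_apply (P Q R S : Pow B E n →ₗ[ℂ] Pow B E n) (x : Pow B E (n + 1)) :
    block P Q R S x = pair (P (fstL n x) + Q (sndL n x)) (R (fstL n x) + S (sndL n x)) := rfl

lemma double_apply (P : Pow B E n →ₗ[ℂ] Pow B E n) (x : Pow B E (n + 1)) :
    double P x = pair (P (fstL n x)) (P (sndL n x)) := by
  simp [double, block_apply]

lemma diag_mul_apply (S T : Module.End ℂ E) (x : Pow B E n) :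
    diag n (S * T) x = diag n S (diag n T x) := rfl

lemma diag_one_apply (x : Pow B E n) : diag n (1 : Module.End ℂ E) x = x := rfl

lemma diag_add_apply (S T : Module.End ℂ E) (x : Pow B E n) :
    diag n (S + T) x = diag n S x + diag n T x := rfl

lemma bddPart_diag (R : Module.End ℂ E) :
    bddPart (diag n R : Module.End ℂ (Pow B E n)) = diag n (bddPart R) := rfl

lemma bddPart'_diag (R : Module.End ℂ E) :
    bddPart' (diag n R : Module.End ℂ (Pow B E n)) = diag n (bddPart' R) := rfl

lemma diag_comm {S T : Module.End ℂ E} (h : Commute S T) (x : Pow B E n) :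
    diag n S (diag n T x) = diag n T (diag n S x) := by
  rw [← diag_mul_apply, h.eq, diag_mul_apply]

lemma diag_succ_apply (T : Module.End ℂ E) (x : Pow B E (n + 1)) :
    diag (n + 1) T x = pair (diag n T (fstL n x)) (diag n T (sndL n x)) :=
  pair_ext rfl rfl

variable {R S T : Module.End ℂ E}

lemma diag_graphIso (h : Commute T R) (x : Pow B E n) :
    diag (n + 1) T (graphIso n R x) = graphIso n R (diag n T x) := by
  simp only [graphIso_apply, diag_succ_apply, fstL_pair, sndL_pair, diag_comm h,
    diag_comm (commute_bddPart h)]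

lemma diag_graphIso' (h : Commute T R) (x : Pow B E n) :
    diag (n + 1) T (graphIso' n R x) = graphIso' n R (diag n T x) := by
  simp only [graphIso'_apply, diag_succ_apply, fstL_pair, sndL_pair, map_neg, diag_comm h,
    diag_comm (commute_bddPart h)]

lemma diag_graphProj (h : Commute T S) (x : Pow B E (n + 1)) :
    diag n T (graphProj n S x) = graphProj n S (diag (n + 1) T x) := by
  simp only [graphProj_apply, diag_succ_apply, fstL_pair, sndL_pair, map_add, diag_comm h,
    diag_comm (commute_bddPart' h)]

lemma diag_graphProj' (h : Commute T S) (x : Pow B E (n + 1)) :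
    diag n T (graphProj' n S x) = graphProj' n S (diag (n + 1) T x) := by
  simp only [graphProj'_apply, diag_succ_apply, fstL_pair, sndL_pair, map_sub, diag_comm h,
    diag_comm (commute_bddPart' h)]

/-- An operator commuting with D passes through the isometries. It is needed for p_n inside the
compression with p_{n+1}. -/
lemma double_graphIso {P : Pow B E n →ₗ[ℂ] Pow B E n} (h : ∀ x, P (diag n R x) = diag n R (P x))
    (x : Pow B E n) : double P (graphIso n R x) = graphIso n R (P x) := by
  have h' : ∀ x, P (diag n (bddPart R) x) = diag n (bddPart R) (P x) := fun x => by
    rw [← bddPart_diag]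
    simp only [bddPart, LinearMap.sub_apply, LinearMap.smul_apply, Module.End.one_apply, map_sub,
      map_smul, h]
  simp only [double_apply, graphIso_apply, fstL_pair, sndL_pair, h, h']

lemma double_graphIso' {P : Pow B E n →ₗ[ℂ] Pow B E n} (h : ∀ x, P (diag n R x) = diag n R (P x))
    (x : Pow B E n) : double P (graphIso' n R x) = graphIso' n R (P x) := by
  have h' : ∀ x, P (diag n (bddPart R) x) = diag n (bddPart R) (P x) := fun x => by
    rw [← bddPart_diag]
    simp only [bddPart, LinearMap.sub_apply, LinearMap.smul_apply, Module.End.one_apply, map_sub,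
      map_smul, h]
  simp only [double_apply, graphIso'_apply, fstL_pair, sndL_pair, map_neg, h, h']

lemma graphProj'_double {P : Pow B E n →ₗ[ℂ] Pow B E n} (h : ∀ x, P (diag n S x) = diag n S (P x))
    (x : Pow B E (n + 1)) : graphProj' n S (double P x) = P (graphProj' n S x) := by
  have h' : ∀ x, P (diag n (bddPart' S) x) = diag n (bddPart' S) (P x) := fun x => by
    rw [← bddPart'_diag]
    simp only [bddPart', LinearMap.add_apply, LinearMap.smul_apply, Module.End.one_apply, map_add,
      map_smul, h]
  simp only [double_apply, graphProj'_apply, fstL_pair, sndL_pair, map_sub, h, h']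

lemma graphProj_graphIso (h : ResolventRel R S) (x : Pow B E n) :
    graphProj n S (graphIso n R x) = x := by
  simp only [graphProj_apply, graphIso_apply, fstL_pair, sndL_pair, ← diag_mul_apply,
    ← diag_add_apply, h.sum_eq_one, diag_one_apply]

lemma graphProj'_graphIso' (h : ResolventRel R S) (x : Pow B E n) :
    graphProj' n S (graphIso' n R x) = x := by
  simp only [graphProj'_apply, graphIso'_apply, fstL_pair, sndL_pair, map_neg, sub_neg_eq_add,
    ← diag_mul_apply, ← diag_add_apply, h.sum_eq_one, diag_one_apply]

lemma graphProj_graphIso' (h : ResolventRel R S) (x : Pow B E n) :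
    graphProj n S (graphIso' n R x) = 0 := by
  simp only [graphProj_apply, graphIso'_apply, fstL_pair, sndL_pair, map_neg, ← diag_mul_apply,
    ← h.mul_bddPart', (commute_bddPart' h.comm).eq, neg_add_cancel]

lemma graphProj'_graphIso (h : ResolventRel R S) (x : Pow B E n) :
    graphProj' n S (graphIso n R x) = 0 := by
  simp only [graphProj'_apply, graphIso_apply, fstL_pair, sndL_pair, ← diag_mul_apply,
    ← h.mul_bddPart', (commute_bddPart' h.comm).eq, sub_self]

lemma graphIso_sum (h : ResolventRel R S) (x : Pow B E (n + 1)) :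
    graphIso n R (graphProj n S x) + graphIso' n R (graphProj' n S x) = x := by
  have c1 : bddPart R * bddPart' S + R * S = 1 := by rw [add_comm]; exact h.sum_eq_one'
  apply pair_ext
  · change diag n R (graphProj n S x) + -diag n (bddPart R) (graphProj' n S x) = _
    simp only [graphProj_apply, graphProj'_apply, map_add, map_sub, ← diag_mul_apply,
      h.mul_bddPart'_eq]
    rw [neg_sub, add_add_sub_cancel, ← diag_add_apply, h.sum_eq_one', diag_one_apply]
  · change diag n (bddPart R) (graphProj n S x) + diag n R (graphProj' n S x) = _
    simp only [graphProj_apply, graphProj'_apply, map_add, map_sub, ← diag_mul_apply,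
      h.mul_bddPart'_eq]
    rw [add_comm (diag n (bddPart R * S) _), add_add_sub_cancel, ← diag_add_apply, c1,
      diag_one_apply]

variable {D : E →ₗ.[ℂ] E}

/-- The matrix of p_{n+1} factors as the column (R, DR) times the row (S, DS). -/
lemma woronowicz_apply (h : IsResolvent D R I) (h' : IsResolvent D S (-I))
    (x : Pow B E (n + 1)) : woronowicz B D n x = graphIso n R (graphProj n S x) := by
  have hn := h.diag (B := B) n
  have hn' := h'.diag (B := B) n
  have hrel := h.resolventRel h'
  rw [woronowicz]
  simp only [total_invOnePlusSq hn hn', total_pcomp_invOnePlusSq hn hn',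
    total_pcomp_sq_invOnePlusSq hn hn', bddPart_diag, bddPart'_diag]
  apply pair_ext
  · simp only [block_apply, graphIso_apply, graphProj_apply, fstL_pair, map_add]
    congr 1
    rw [← diag_mul_apply, hrel.mul_bddPart'_eq]
    rfl
  · simp only [block_apply, graphIso_apply, graphProj_apply, sndL_pair, map_add]
    rfl

lemma id_sub_woronowicz_apply (h : IsResolvent D R I) (h' : IsResolvent D S (-I))
    (x : Pow B E (n + 1)) :
    (LinearMap.id - woronowicz B D n : Pow B E (n + 1) →ₗ[ℂ] Pow B E (n + 1)) x =
      graphIso' n R (graphProj' n S x) := by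
  rw [LinearMap.sub_apply, woronowicz_apply h h', LinearMap.id_apply, sub_eq_iff_eq_add',
    graphIso_sum (h.resolventRel h')]

section

variable [NonUnitalCStarAlgebra B] [PartialOrder B] [StarOrderedRing B] [SMul B E]
  [CStarModule B E]

lemma inner_pow_succ (x y : Pow B E (n + 1)) :
    inner B x y = inner B (fstL n x) (fstL n y) + inner B (sndL n x) (sndL n y) :=
  Fintype.sum_sum_type (α₁ := Idx n) (α₂ := Idx n) fun i => inner B (x i) (y i)

lemma ResolventPair.adj_graphIso (h : ResolventPair B D R S) (n : ℕ) :
    AdjPair B (graphIso n R : Pow B E n →ₗ[ℂ] Pow B E (n + 1)) (graphProj n S) := fun x y => by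
  rw [inner_pow_succ, graphProj_apply, CStarModule.inner_add_right, ← h.adj.diag n,
    ← h.adj_bddPart.diag n]
  rfl

lemma ResolventPair.adj_graphIso' (h : ResolventPair B D R S) (n : ℕ) :
    AdjPair B (graphIso' n R : Pow B E n →ₗ[ℂ] Pow B E (n + 1)) (graphProj' n S) := fun x y => by
  rw [inner_pow_succ, graphProj'_apply, CStarModule.inner_sub_right, ← h.adj.diag n,
    ← h.adj_bddPart.diag n, sub_eq_neg_add, ← CStarModule.inner_neg_left]
  rfl

end

end Columns

/-! ### Isometries of `E` into `E^(2^n)` -/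

section Isometries

variable {B E : Type*} [NormedAddCommGroup E] [NormedSpace ℂ E]

variable (B) in
/-- The isometry of `E` onto the range of `p₁ ⋯ p_n`. -/
def iso (R : Module.End ℂ E) : (n : ℕ) → E →ₗ[ℂ] Pow B E n
  | 0 => { toFun := fun x => fun _ => x, map_add' := fun _ _ => rfl, map_smul' := fun _ _ => rfl }
  | n + 1 => graphIso n R ∘ₗ iso R n

variable (B) in
/-- The isometry of `E` onto the range of `p₁^⊥ ⋯ p_n^⊥`. -/
def iso' (R : Module.End ℂ E) : (n : ℕ) → E →ₗ[ℂ] Pow B E n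
  | 0 => { toFun := fun x => fun _ => x, map_add' := fun _ _ => rfl, map_smul' := fun _ _ => rfl }
  | n + 1 => graphIso' n R ∘ₗ iso' R n

variable (B) in
/-- The adjoint of `iso`. -/
def coiso (S : Module.End ℂ E) : (n : ℕ) → Pow B E n →ₗ[ℂ] E
  | 0 => { toFun := fun x => x (() : Unit), map_add' := fun _ _ => rfl,
           map_smul' := fun _ _ => rfl }
  | n + 1 => coiso S n ∘ₗ graphProj n S

variable (B) in
/-- The adjoint of `iso'`. -/
def coiso' (S : Module.End ℂ E) : (n : ℕ) → Pow B E n →ₗ[ℂ] E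
  | 0 => { toFun := fun x => x (() : Unit), map_add' := fun _ _ => rfl,
           map_smul' := fun _ _ => rfl }
  | n + 1 => coiso' S n ∘ₗ graphProj' n S

variable {R S T : Module.End ℂ E} {n : ℕ}

lemma diag_iso (h : Commute T R) (x : E) : diag n T (iso B R n x) = iso B R n (T x) := by
  induction n with
  | zero => rfl
  | succ n ih => exact (diag_graphIso h _).trans (congrArg _ ih)

lemma diag_iso' (h : Commute T R) (x : E) : diag n T (iso' B R n x) = iso' B R n (T x) := by
  induction n with
  | zero => rfl
  | succ n ih => exact (diag_graphIso' h _).trans (congrArg _ ih)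

lemma coiso_diag (h : Commute T S) (x : Pow B E n) :
    coiso B S n (diag n T x) = T (coiso B S n x) := by
  induction n with
  | zero => rfl
  | succ n ih => exact (congrArg _ (diag_graphProj h _).symm).trans (ih _)

lemma coiso'_diag (h : Commute T S) (x : Pow B E n) :
    coiso' B S n (diag n T x) = T (coiso' B S n x) := by
  induction n with
  | zero => rfl
  | succ n ih => exact (congrArg _ (diag_graphProj' h _).symm).trans (ih _)

lemma coiso_iso (h : ResolventRel R S) (x : E) : coiso B S n (iso B R n x) = x := by
  induction n with
  | zero => rfl
  | succ n ih => exact (congrArg _ (graphProj_graphIso h _)).trans ih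

lemma coiso'_iso' (h : ResolventRel R S) (x : E) : coiso' B S n (iso' B R n x) = x := by
  induction n with
  | zero => rfl
  | succ n ih => exact (congrArg _ (graphProj'_graphIso' h _)).trans ih

lemma coiso_iso' (h : ResolventRel R S) (x : E) :
    coiso B S (n + 1) (iso' B R (n + 1) x) = 0 :=
  (congrArg (coiso B S n) (graphProj_graphIso' h _)).trans (map_zero _)

lemma coiso'_iso (h : ResolventRel R S) (x : E) :
    coiso' B S (n + 1) (iso B R (n + 1) x) = 0 :=
  (congrArg (coiso' B S n) (graphProj'_graphIso h _)).trans (map_zero _)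

variable (B R S n) in
/-- The operator on `E^(2^n)` that is `T` on the range of `p₁ ⋯ p_n` and `V` on the range of
`p₁^⊥ ⋯ p_n^⊥`, both identified with `E`. -/
def corner (T V : Module.End ℂ E) : Module.End ℂ (Pow B E n) :=
  iso B R n ∘ₗ T ∘ₗ coiso B S n + iso' B R n ∘ₗ V ∘ₗ coiso' B S n

lemma corner_apply (T V : Module.End ℂ E) (x : Pow B E n) :
    corner B R S n T V x = iso B R n (T (coiso B S n x)) + iso' B R n (V (coiso' B S n x)) := rfl

variable {Q T' V V' C C' : Module.End ℂ E}

lemma corner_mul_diag (h : Commute Q S) :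
    corner B R S n T V * diag n Q = corner B R S n (T * Q) (V * Q) :=
  LinearMap.ext fun x => by
    rw [Module.End.mul_apply, corner_apply, corner_apply, coiso_diag h, coiso'_diag h]
    rfl

lemma diag_mul_corner (h : Commute Q R) :
    diag n Q * corner B R S n T V = corner B R S n (Q * T) (Q * V) :=
  LinearMap.ext fun x => by
    rw [Module.End.mul_apply, corner_apply, corner_apply, map_add, diag_iso h, diag_iso' h]
    rfl

lemma corner_add : corner B R S n T V + corner B R S n T' V' =
    corner B R S n (T + T') (V + V') :=
  LinearMap.ext fun x => by
    simp only [LinearMap.add_apply, corner_apply, map_add]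
    abel

lemma corner_sub : corner B R S n T V - corner B R S n T' V' =
    corner B R S n (T - T') (V - V') :=
  LinearMap.ext fun x => by
    simp only [LinearMap.sub_apply, corner_apply, map_sub]
    abel

lemma smul_corner (c : ℂ) : c • corner B R S n T V = corner B R S n (c • T) (c • V) :=
  LinearMap.ext fun x => by
    simp only [LinearMap.smul_apply, corner_apply, map_smul, smul_add]

/-- If `[D, T] = C`, then `next R T T' C = (D + i) T (D + i)⁻¹`. -/
def next {𝒜 : Type*} [Ring 𝒜] [Algebra ℂ 𝒜] (R T T' C : 𝒜) : 𝒜 :=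
  C * R + T' * bddPart R + I • (T * R)

lemma CommEq.eq_next {𝒜 : Type*} [Ring 𝒜] [Algebra ℂ 𝒜] {R T T' C : 𝒜} (h : CommEq R T T' C) :
    T * R = R * next R T T' C := h

/-- If `[D, T] = C`, then this is `(D - i)⁻¹ T' (D - i)`. -/
def lowerNext {𝒜 : Type*} [Ring 𝒜] [Algebra ℂ 𝒜] (R S T T' C : 𝒜) : 𝒜 :=
  bddPart' S * T * bddPart R - S * C * bddPart R + S * T' * R

lemma next_corner (h : ResolventRel R S) :
    next (diag n R) (corner B R S n T V) (corner B R S n T' V') (corner B R S n C C') =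
      corner B R S n (next R T T' C) (next R V V' C') := by
  rw [next, bddPart_diag, corner_mul_diag h.comm,
    corner_mul_diag (commute_bddPart h.comm.symm).symm, corner_mul_diag h.comm, smul_corner,
    corner_add, corner_add]
  rfl

lemma lowerNext_corner (h : ResolventRel R S) :
    lowerNext (diag n R) (diag n S) (corner B R S n T V) (corner B R S n T' V')
        (corner B R S n C C') =
      corner B R S n (lowerNext R S T T' C) (lowerNext R S V V' C') := by
  have h1 : Commute (bddPart R) S := (commute_bddPart h.comm.symm).symm
  have h2 : Commute (bddPart' S) R := (commute_bddPart' h.comm).symm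
  rw [lowerNext, bddPart_diag, bddPart'_diag, diag_mul_corner h2, corner_mul_diag h1,
    diag_mul_corner h.comm.symm, corner_mul_diag h1, diag_mul_corner h.comm.symm,
    corner_mul_diag h.comm, corner_sub, corner_add]
  rfl

lemma commEq_corner (h : ResolventRel R S) (hT : CommEq R T T' C) (hV : CommEq R V V' C') :
    CommEq (diag n R) (corner B R S n T V) (corner B R S n T' V') (corner B R S n C C') := by
  refine Eq.trans ?_ (congrArg (diag n R * ·) (next_corner h)).symm
  rw [corner_mul_diag h.comm, diag_mul_corner (Commute.refl R), hT.eq_next, hV.eq_next]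

/-- Compression of a commutator by an isometry that intertwines `R`. -/
lemma commEq_compress {n : ℕ} {θ θ' C : Module.End ℂ (Pow B E n)} {w : E →ₗ[ℂ] Pow B E n}
    {w' : Pow B E n →ₗ[ℂ] E} (hw : ∀ T, Commute T R → ∀ x, diag n T (w x) = w (T x))
    (hw' : ∀ x, w' (diag n R x) = R (w' x)) (hT : ∀ x, w' (θ (w x)) = T x)
    (hT' : ∀ x, w' (θ' (w x)) = T' x) (h : CommEq (diag n R) θ θ' C) :
    CommEq R T T' (w' ∘ₗ C ∘ₗ w) := by
  have hR := hw R (Commute.refl R)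
  have hG := hw (bddPart R) (commute_bddPart (Commute.refl R)).symm
  refine LinearMap.ext fun x => ?_
  have e := congrArg w' (LinearMap.congr_fun h (w x))
  simp only [Module.End.mul_apply, LinearMap.add_apply, LinearMap.smul_apply, bddPart_diag, hw',
    hR, hG, map_add, map_smul, hT, hT'] at e
  simp only [Module.End.mul_apply, LinearMap.add_apply, LinearMap.smul_apply, map_add, map_smul,
    LinearMap.comp_apply]
  exact e

section Compression

variable {D : E →ₗ.[ℂ] E} {θ θ' c : Module.End ℂ (Pow B E n)}

/-- On a graph vector (y, Dy) the second component is [D,θ]y + θ'Dy = Dθy, so the graph is preserved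
and no projection is needed to identify the result. -/
lemma block_graphIso (h : CommEq (diag n R) θ θ' c) (x : Pow B E n) :
    block θ 0 c θ' (graphIso n R x) = graphIso n R (next (diag n R) θ θ' c x) := by
  have e1 := LinearMap.congr_fun h.eq_next x
  have e2 := LinearMap.congr_fun h.mul_eq x
  rw [graphIso_apply, graphIso_apply, block_apply]
  apply pair_ext
  · simpa using e1
  · exact eq_sub_iff_add_eq.1 e2

lemma graphProj'_block_graphIso' (x : Pow B E n) :
    graphProj' n S (block θ 0 c θ' (graphIso' n R x)) =
      lowerNext (diag n R) (diag n S) θ θ' c x := by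
  simp only [graphIso'_apply, block_apply, graphProj'_apply, fstL_pair, sndL_pair, lowerNext,
    LinearMap.add_apply, LinearMap.sub_apply, Module.End.mul_apply, LinearMap.zero_apply, map_add,
    map_neg, add_zero, bddPart_diag, bddPart'_diag]
  abel

lemma compress_zero_block (hR : IsResolvent D R I) (hS : IsResolvent D S (-I))
    {θ θ' c : Module.End ℂ (Pow B E 0)} (h : CommEq (diag 0 R) θ θ' c) :
    compress D 0 (block θ 0 c θ') =
      graphIso 0 R ∘ₗ next (diag 0 R) θ θ' c ∘ₗ graphProj 0 S +
        graphIso' 0 R ∘ₗ lowerNext (diag 0 R) (diag 0 S) θ θ' c ∘ₗ graphProj' 0 S := by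
  refine LinearMap.ext fun x => ?_
  simp only [compress, LinearMap.add_apply, LinearMap.comp_apply, woronowicz_apply hR hS,
    id_sub_woronowicz_apply hR hS, block_graphIso h, graphProj'_block_graphIso',
    graphProj_graphIso (hR.resolventRel hS)]

lemma woronowicz_diag (hR : IsResolvent D R I) (hS : IsResolvent D S (-I)) (h : Commute T R)
    (h' : Commute T S) (x : Pow B E (n + 1)) :
    woronowicz B D n (diag (n + 1) T x) = diag (n + 1) T (woronowicz B D n x) := by
  rw [woronowicz_apply hR hS, woronowicz_apply hR hS, diag_graphIso h, diag_graphProj h']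

/-- Since p_n commutes with D, it moves through the isometries for p_{n+1} and ends up compressing
only the inner operator. -/
lemma compress_succ_block (hR : IsResolvent D R I) (hS : IsResolvent D S (-I))
    {θ θ' c : Module.End ℂ (Pow B E (n + 1))} (h : CommEq (diag (n + 1) R) θ θ' c) :
    compress D (n + 1) (block θ 0 c θ') =
      graphIso (n + 1) R ∘ₗ (woronowicz B D n ∘ₗ next (diag (n + 1) R) θ θ' c ∘ₗ
        woronowicz B D n) ∘ₗ graphProj (n + 1) S +
      graphIso' (n + 1) R ∘ₗ ((LinearMap.id - woronowicz B D n) ∘ₗ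
        lowerNext (diag (n + 1) R) (diag (n + 1) S) θ θ' c ∘ₗ
        (LinearMap.id - woronowicz B D n)) ∘ₗ graphProj' (n + 1) S := by
  have hrel := hR.resolventRel hS
  have p1 : ∀ x : Pow B E (n + 1), woronowicz B D n (diag (n + 1) R x) =
      diag (n + 1) R (woronowicz B D n x) := woronowicz_diag hR hS (Commute.refl R) hrel.comm
  have p2 : ∀ x : Pow B E (n + 1), woronowicz B D n (diag (n + 1) S x) =
      diag (n + 1) S (woronowicz B D n x) := woronowicz_diag hR hS hrel.comm.symm (Commute.refl S)
  have p3 : ∀ x : Pow B E (n + 1), (LinearMap.id - woronowicz B D n :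
      Pow B E (n + 1) →ₗ[ℂ] Pow B E (n + 1)) (diag (n + 1) R x) = diag (n + 1) R
        ((LinearMap.id - woronowicz B D n : Pow B E (n + 1) →ₗ[ℂ] Pow B E (n + 1)) x) :=
    fun x => by simp only [LinearMap.sub_apply, LinearMap.id_apply, map_sub, p1]
  have p4 : ∀ x : Pow B E (n + 1), (LinearMap.id - woronowicz B D n :
      Pow B E (n + 1) →ₗ[ℂ] Pow B E (n + 1)) (diag (n + 1) S x) = diag (n + 1) S
        ((LinearMap.id - woronowicz B D n : Pow B E (n + 1) →ₗ[ℂ] Pow B E (n + 1)) x) :=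
    fun x => by simp only [LinearMap.sub_apply, LinearMap.id_apply, map_sub, p2]
  refine LinearMap.ext fun x => ?_
  simp only [compress]
  rw [LinearMap.add_apply, LinearMap.add_apply]
  congr 1
  · simp only [LinearMap.comp_apply]
    rw [woronowicz_apply hR hS (n := n + 1), woronowicz_apply hR hS (n := n + 1),
      double_graphIso p1, block_graphIso h, double_graphIso p1, graphProj_graphIso hrel]
  · simp only [LinearMap.comp_apply]
    rw [id_sub_woronowicz_apply hR hS (n := n + 1), id_sub_woronowicz_apply hR hS (n := n + 1),
      double_graphIso' p3, graphProj'_double p4, graphProj'_block_graphIso']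

/-- For n+1 ≥ 1 the two copies of E lie in the ranges of p_{n+1} and its complement respectively, so
the projection retains exactly one corner. -/
lemma iso_woronowicz (hR : IsResolvent D R I) (hS : IsResolvent D S (-I)) (T V : Module.End ℂ E) :
    woronowicz B D n ∘ₗ corner B R S (n + 1) T V ∘ₗ woronowicz B D n =
      iso B R (n + 1) ∘ₗ T ∘ₗ coiso B S (n + 1) := by
  have hrel := hR.resolventRel hS
  refine LinearMap.ext fun x => ?_
  simp only [LinearMap.comp_apply, corner_apply, woronowicz_apply hR hS, iso, iso', coiso, coiso',
    graphProj_graphIso hrel, graphProj'_graphIso hrel, map_zero, add_zero]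

lemma iso'_woronowicz (hR : IsResolvent D R I) (hS : IsResolvent D S (-I))
    (T V : Module.End ℂ E) :
    (LinearMap.id - woronowicz B D n) ∘ₗ corner B R S (n + 1) T V ∘ₗ
        (LinearMap.id - woronowicz B D n) =
      iso' B R (n + 1) ∘ₗ V ∘ₗ coiso' B S (n + 1) := by
  have hrel := hR.resolventRel hS
  refine LinearMap.ext fun x => ?_
  simp only [LinearMap.comp_apply, corner_apply, id_sub_woronowicz_apply hR hS, iso, iso', coiso,
    coiso', graphProj'_graphIso' hrel, graphProj_graphIso' hrel, map_zero, zero_add]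

lemma compress_zero_diag (hR : IsResolvent D R I) (hS : IsResolvent D S (-I))
    (h : CommEq R T T' C) :
    compress D 0 (block (diag 0 T) 0 (diag 0 C) (diag 0 T')) =
      corner B R S 1 (next R T T' C) (lowerNext R S T T' C) :=
  compress_zero_block hR hS (LinearMap.ext fun x => funext fun i => LinearMap.congr_fun h (x i))

lemma compress_succ_corner (hR : IsResolvent D R I) (hS : IsResolvent D S (-I))
    (h : CommEq R T T' C) (h' : CommEq R V V' C') :
    compress D (n + 1) (block (corner B R S (n + 1) T V) 0 (corner B R S (n + 1) C C')
        (corner B R S (n + 1) T' V')) =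
      corner B R S (n + 2) (next R T T' C) (lowerNext R S V V' C') := by
  have hrel := hR.resolventRel hS
  rw [compress_succ_block hR hS (commEq_corner hrel h h'), next_corner hrel,
    lowerNext_corner hrel, iso_woronowicz hR hS, iso'_woronowicz hR hS]
  rfl

end Compression

section

variable [NonUnitalCStarAlgebra B] [PartialOrder B] [StarOrderedRing B] [SMul B E]
  [CStarModule B E] {D : E →ₗ.[ℂ] E}

lemma ResolventPair.adj_iso (h : ResolventPair B D R S) (n : ℕ) :
    AdjPair B (iso B R n) (coiso B S n) := by
  induction n with
  | zero => exact fun x y => Fintype.sum_unique (ι := Unit) _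
  | succ n ih => exact (h.adj_graphIso n).comp ih

lemma ResolventPair.adj_iso' (h : ResolventPair B D R S) (n : ℕ) :
    AdjPair B (iso' B R n) (coiso' B S n) := by
  induction n with
  | zero => exact fun x y => Fintype.sum_unique (ι := Unit) _
  | succ n ih => exact (h.adj_graphIso' n).comp ih

lemma ResolventPair.isAdj_corner (h : ResolventPair B D R S) (n : ℕ) (hT : IsAdj B T)
    (hV : IsAdj B V) : IsAdj B (corner B R S n T V) :=
  (IsAdj.comp ⟨_, h.adj_iso n⟩ (hT.comp ⟨_, (h.adj_iso n).symm⟩)).add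
    (IsAdj.comp ⟨_, h.adj_iso' n⟩ (hV.comp ⟨_, (h.adj_iso' n).symm⟩))

end

end Isometries

/-! ### Conjugation by powers of D + i -/

section Lift

variable (B : Type*) [NonUnitalCStarAlgebra B] [PartialOrder B]
variable {X : Type*} [AddCommGroup X] [Module ℂ X] [Norm X] [SMul B X] [CStarModule B X]

/-- `(D + i)^k T (D + i)^(-k)` is adjointable for all `k ≤ m`, in terms of `R = (D + i)⁻¹`. -/
def Liftable (R : Module.End ℂ X) (m : ℕ) (T : Module.End ℂ X) : Prop :=
  ∀ k ≤ m, ∃ C, IsAdj B C ∧ T * R ^ k = R ^ k * C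

variable {B} {R S T : Module.End ℂ X} {m : ℕ} {D : X →ₗ.[ℂ] X}

lemma Liftable.mono {k : ℕ} (h : Liftable B R m T) (hk : k ≤ m) : Liftable B R k T :=
  fun j hj => h j (hj.trans hk)

lemma liftable_zero (h : IsAdj B T) : Liftable B R 0 T := fun k hk => by
  obtain rfl := Nat.le_zero.1 hk
  exact ⟨T, h, by simp⟩

lemma Liftable.isAdj (h : Liftable B R m T) : IsAdj B T := by
  obtain ⟨C, hC, e⟩ := h 0 (Nat.zero_le m)
  rw [pow_zero, mul_one, one_mul] at e
  rwa [e]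

lemma Liftable.neg (h : Liftable B R m T) : Liftable B R m (-T) := fun k hk => by
  obtain ⟨C, hC, e⟩ := h k hk
  exact ⟨-C, hC.neg, by rw [neg_mul, e, mul_neg]⟩

lemma pow_mul_cayley {𝒜 : Type*} [Ring 𝒜] [Algebra ℂ 𝒜] {R S : 𝒜} (h : ResolventRel R S) (k : ℕ) :
    S ^ k * ResolventRel.cayley R ^ k = R ^ k := by
  have c : Commute S (ResolventRel.cayley R) :=
    (Commute.one_right S).sub_right (h.comm.symm.smul_right _)
  rw [← c.mul_pow, h.mul_cayley]

lemma pow_mul_cayley' {𝒜 : Type*} [Ring 𝒜] [Algebra ℂ 𝒜] {R S : 𝒜} (h : ResolventRel R S)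
    (k : ℕ) : R ^ k * ResolventRel.cayley' S ^ k = S ^ k := by
  have c : Commute R (ResolventRel.cayley' S) :=
    (Commute.one_right R).add_right (h.comm.smul_right _)
  rw [← c.mul_pow, h.mul_cayley']

lemma conj_pow {𝒜 : Type*} [Ring 𝒜] [Algebra ℂ 𝒜] {R S g : 𝒜} (hg : g * g = 1)
    (hgR : g * R * g = -S) (k : ℕ) : g * R ^ k * g = (-1 : ℂ) ^ k • S ^ k := by
  induction k with
  | zero => simp [hg]
  | succ k ih =>
    have : g * R ^ (k + 1) * g = (g * R ^ k * g) * (g * R * g) := by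
      calc g * R ^ (k + 1) * g = g * R ^ k * 1 * R * g := by
            rw [pow_succ, mul_one]; simp only [mul_assoc]
        _ = _ := by rw [← hg]; simp only [mul_assoc]
    rw [this, ih, hgR, pow_succ, pow_succ, mul_neg, smul_mul_assoc]
    module

/-- Conjugation by an involution that maps `(D + i)⁻¹` to `-(D - i)⁻¹`. -/
lemma Liftable.conj (hR : ResolventPair B D R S) {g : Module.End ℂ X} (hg : g * g = 1)
    (hgR : g * R * g = -S) (hgadj : ∀ T : Module.End ℂ X, IsAdj B T → IsAdj B (g * T * g))
    (h : Liftable B R m T) : Liftable B R m (g * T * g) := fun k hk => by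
  obtain ⟨C, hC, e⟩ := h k hk
  -- The grading turns R^k into ±S^k, so gCg intertwines powers of S. The Cayley factors turn S^k
  -- back into R^k on both sides.
  refine ⟨ResolventRel.cayley' S ^ k * (g * C * g) * ResolventRel.cayley R ^ k,
    ((hR.isAdj_cayley'.pow k).mul (hgadj C hC)).mul (hR.isAdj_cayley.pow k), ?_⟩
  have ins : ∀ x y : Module.End ℂ X, g * (x * y) * g = (g * x * g) * (g * y * g) := fun x y => by
    calc g * (x * y) * g = g * x * 1 * y * g := by simp only [mul_one, mul_assoc]
      _ = _ := by rw [← hg]; simp only [mul_assoc]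
  have e1 : g * T * g * S ^ k = S ^ k * (g * C * g) := by
    have e2 := congrArg (fun x => g * x * g) e
    simp only [ins, conj_pow hg hgR, mul_smul_comm, smul_mul_assoc] at e2
    exact smul_right_injective _ (pow_ne_zero k (by norm_num : (-1 : ℂ) ≠ 0)) e2
  rw [← mul_assoc, ← mul_assoc, pow_mul_cayley' hR.rel, ← e1, mul_assoc (g * T * g) (S ^ k),
    pow_mul_cayley hR.rel]

/-- Reduces the corner on the complement of the graph to the one on the graph: (D-i)⁻¹V'(D-i) is
formally adjoint to (D+i)V'*(D+i)⁻¹. -/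
lemma adjPair_lowerNext (h : ResolventPair B D R S) {V V' C Vs Vs' Cs : Module.End ℂ X}
    (hV : AdjPair B V Vs) (hV' : AdjPair B V' Vs') (hC : AdjPair B C Cs) (e : CommEq R V V' C) :
    AdjPair B (lowerNext R S V V' C) (next R Vs' Vs (-Cs)) := by
  have e1 := h.commEq_adjoint hV hV' hC e
  have e2 : Cs * R = Vs * bddPart R - bddPart R * next R Vs' Vs (-Cs) := by
    have : -Cs * R = bddPart R * next R Vs' Vs (-Cs) - Vs * bddPart R := e1.mul_eq
    rw [← neg_sub, ← this, neg_mul, neg_neg]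
  have hl := (((h.adj_bddPart.symm.mul hV).mul h.adj_bddPart).sub
    ((h.adj.symm.mul hC).mul h.adj_bddPart)).add ((h.adj.symm.mul hV').mul h.adj)
  rw [lowerNext]
  convert hl using 1
  -- Substituting for C*R and V'*R leaves DS·DR + SR in front of the `next` term, which is 1.
  rw [e2, e1.eq_next, ← mul_assoc S R, mul_sub, sub_sub_cancel, ← mul_assoc, ← add_mul,
    add_comm (bddPart' S * bddPart R), h.rel.sum_eq_one, one_mul]

lemma commEq_unique (h : ResolventPair B D R S) {T T' C C' : Module.End ℂ X} (hC : IsAdj B C)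
    (hC' : IsAdj B C') (e : CommEq R T T' C) (e' : CommEq R T T' C') : C = C' := by
  refine h.cancel_right hC hC' ?_
  have := h.res.cancel_left (e.symm.trans e')
  rwa [add_left_inj, add_left_inj] at this

end Lift

/-! ### The corners of θ_n(a) and the Sobolev subalgebras -/

section Theta

variable {A B E : Type*} [NonUnitalCStarAlgebra A]
  [NonUnitalCStarAlgebra B] [PartialOrder B] [StarOrderedRing B]
  [NormedAddCommGroup E] [NormedSpace ℂ E] [SMul B E] [CStarModule B E]
  {D : E →ₗ.[ℂ] E} {R S : Module.End ℂ E}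

lemma extension_pdiag_spec (h : IsResolvent D R I) {n : ℕ} {T T' : Module.End ℂ (Pow B E n)}
    (hm : MemEnd B (pdiag n D) (gradedCommutator (pdiag n D) T T')) :
    IsAdj B (extension B (gradedCommutator (pdiag n D) T T')) ∧
      CommEq (diag n R) T T' (extension B (gradedCommutator (pdiag n D) T T')) := by
  refine (h.diag n).extends_gradedCommutator_iff.1 ⟨hm.1, ?_⟩
  rw [extension, dif_pos hm.2]
  exact hm.2.choose_spec

lemma memEnd_diag_zero_iff (h : ResolventPair B D R S) {T T' : Module.End ℂ E} :
    MemEnd B (pdiag 0 D : Pow B E 0 →ₗ.[ℂ] Pow B E 0)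
        (gradedCommutator (pdiag 0 D) (diag 0 T) (diag 0 T')) ↔
      ∃ C, IsAdj B C ∧ CommEq R T T' C := by
  rw [(h.res.diag 0).memEnd_gradedCommutator_iff]
  constructor
  · rintro ⟨C, hC, e⟩
    exact ⟨coiso B S 0 ∘ₗ C ∘ₗ iso B R 0, IsAdj.comp ⟨_, (h.adj_iso 0).symm⟩
      (hC.comp ⟨_, h.adj_iso 0⟩), commEq_compress (fun _ _ _ => rfl) (fun _ => rfl)
      (fun _ => rfl) (fun _ => rfl) e⟩
  · rintro ⟨C, ⟨Cs, hC⟩, e⟩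
    exact ⟨diag 0 C, ⟨_, hC.diag 0⟩,
      LinearMap.ext fun x => funext fun i => LinearMap.congr_fun e (x i)⟩

/-- The isometries intertwine D, so commutators can be compressed to each copy of E and reassembled
from the two compressions. -/
lemma memEnd_corner_iff (h : ResolventPair B D R S) {n : ℕ} {T T' V V' : Module.End ℂ E} :
    MemEnd B (pdiag (n + 1) D : Pow B E (n + 1) →ₗ.[ℂ] Pow B E (n + 1))
        (gradedCommutator (pdiag (n + 1) D) (corner B R S (n + 1) T V)
          (corner B R S (n + 1) T' V')) ↔
      (∃ C, IsAdj B C ∧ CommEq R T T' C) ∧ ∃ C, IsAdj B C ∧ CommEq R V V' C := by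
  rw [(h.res.diag (n + 1)).memEnd_gradedCommutator_iff]
  constructor
  · rintro ⟨C, hC, e⟩
    refine ⟨⟨coiso B S (n + 1) ∘ₗ C ∘ₗ iso B R (n + 1), IsAdj.comp ⟨_, (h.adj_iso _).symm⟩
      (hC.comp ⟨_, h.adj_iso _⟩), commEq_compress (fun _ => diag_iso)
        (coiso_diag h.rel.comm) ?_ ?_ e⟩,
      ⟨coiso' B S (n + 1) ∘ₗ C ∘ₗ iso' B R (n + 1), IsAdj.comp ⟨_, (h.adj_iso' _).symm⟩
      (hC.comp ⟨_, h.adj_iso' _⟩), commEq_compress (fun _ => diag_iso')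
        (coiso'_diag h.rel.comm) ?_ ?_ e⟩⟩ <;>
    · intro x
      simp only [corner_apply, coiso_iso h.rel, coiso'_iso' h.rel, coiso_iso' h.rel,
        coiso'_iso h.rel, map_zero, add_zero, zero_add]
  · rintro ⟨⟨C, hC, e⟩, ⟨C', hC', e'⟩⟩
    exact ⟨_, h.isAdj_corner _ hC hC', commEq_corner h.rel e e'⟩

namespace GradedBimodule

variable (M : GradedBimodule A B E)

lemma gradE_mul_gradE : (M.gradE : Module.End ℂ E) * M.gradE = 1 :=
  LinearMap.ext M.gradE_gradE

lemma conj_rep (a : A) : (M.gradE : Module.End ℂ E) * M.rep a * M.gradE = M.rep (M.gradA a) :=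
  LinearMap.ext fun x => by
    rw [Module.End.mul_apply, Module.End.mul_apply, M.gradE_rep, M.gradE_gradE]

lemma adjPair_conj {T Ts : Module.End ℂ E} (h : AdjPair B T Ts) :
    AdjPair B ((M.gradE : Module.End ℂ E) * T * M.gradE) (M.gradE * Ts * M.gradE) := fun x y => by
  have h1 := M.inner_gradE (T (M.gradE x)) (M.gradE y)
  have h2 := M.inner_gradE (M.gradE x) (Ts (M.gradE y))
  rw [M.gradE_gradE] at h1 h2
  simp only [Module.End.mul_apply]
  rw [h1, h2, h]

lemma isAdj_conj (T : Module.End ℂ E) (h : IsAdj B T) :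
    IsAdj B ((M.gradE : Module.End ℂ E) * T * M.gradE) :=
  ⟨_, M.adjPair_conj h.choose_spec⟩

lemma adjPair_rep (a : A) : AdjPair B (M.rep a) (M.rep (star a)) := M.inner_rep a

lemma isAdj_rep (a : A) : IsAdj B (M.rep a) := ⟨_, M.adjPair_rep a⟩

variable {M}

lemma IsOdd.hasValue (hodd : M.IsOdd D) {x y : E} (h : HasValue D x y) :
    HasValue D (M.gradE x) (-M.gradE y) := by
  obtain ⟨hx, rfl⟩ := h
  exact hodd ⟨x, hx⟩

lemma IsOdd.conj_resolvent (hodd : M.IsOdd D) (h : ResolventPair B D R S) :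
    (M.gradE : Module.End ℂ E) * R * M.gradE = -S := LinearMap.ext fun x => by
  have h1 := h.res.left_inv (hodd.hasValue (h.res'.value x))
  rw [neg_smul, sub_neg_eq_add, show -M.gradE (x + I • S x) + I • M.gradE (S x) = -M.gradE x by
    rw [map_add, map_smul]; abel] at h1
  simp only [Module.End.mul_apply, LinearMap.neg_apply]
  rw [← M.gradE_gradE (S x), ← h1, map_neg, map_neg, neg_neg]

variable (M) in
/-- `b = [D, c]` is adjointable, and so are `(D + i)^k b (D + i)^(-k)` for `k ≤ n`. -/
def SmoothCommutator (R : Module.End ℂ E) (n : ℕ) (c : A) : Prop :=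
  ∃ b, CommEq R (M.rep c) (M.rep (M.gradA c)) b ∧ Liftable B R n b

lemma SmoothCommutator.mono {n m : ℕ} {c : A} (h : M.SmoothCommutator R n c) (hm : m ≤ n) :
    M.SmoothCommutator R m c := by
  obtain ⟨b, hb, hl⟩ := h
  exact ⟨b, hb, hl.mono hm⟩

lemma SmoothCommutator.gradA (hodd : M.IsOdd D) (h : ResolventPair B D R S) {n : ℕ} {c : A}
    (hc : M.SmoothCommutator R n c) : M.SmoothCommutator R n (M.gradA c) := by
  obtain ⟨b, hb, hl⟩ := hc
  have hg := M.gradE_mul_gradE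
  have hgR := hodd.conj_resolvent h
  refine ⟨-((M.gradE : Module.End ℂ E) * b * M.gradE), ?_,
    (hl.conj h hg hgR M.isAdj_conj).neg⟩
  have := hb.conj h.rel hg hgR
  rwa [M.conj_rep, M.conj_rep] at this

lemma smoothCommutator_gradA_iff (hodd : M.IsOdd D) (h : ResolventPair B D R S) {n : ℕ} {c : A} :
    M.SmoothCommutator R n (M.gradA c) ↔ M.SmoothCommutator R n c := by
  refine ⟨fun hc => ?_, fun hc => hc.gradA hodd h⟩
  have := hc.gradA hodd h
  rwa [M.gradA_gradA] at this

lemma smoothCommutator_iterate_gradA_iff (hodd : M.IsOdd D) (h : ResolventPair B D R S) {n : ℕ}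
    {c : A} (k : ℕ) : M.SmoothCommutator R n (M.gradA^[k] c) ↔ M.SmoothCommutator R n c := by
  induction k with
  | zero => rfl
  | succ k ih => rw [Function.iterate_succ_apply', smoothCommutator_gradA_iff hodd h, ih]

lemma smoothCommutator_zero_iff {c : A} : M.SmoothCommutator R 0 c ↔
    ∃ C, IsAdj B C ∧ CommEq R (M.rep c) (M.rep (M.gradA c)) C :=
  ⟨fun ⟨b, hb, hl⟩ => ⟨b, hl.isAdj, hb⟩, fun ⟨b, hl, hb⟩ => ⟨b, hb, liftable_zero hl⟩⟩

/-- Only the conjugate of order n+1 is new, and it is the commutator of D with the conjugate T of c.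
-/
lemma smoothCommutator_succ_iff (h : ResolventPair B D R S) {n : ℕ} {c : A}
    (hc : M.SmoothCommutator R n c) {T T' : Module.End ℂ E}
    (e : M.rep c * R ^ (n + 1) = R ^ (n + 1) * T)
    (e' : M.rep (M.gradA c) * R ^ (n + 1) = R ^ (n + 1) * T') :
    M.SmoothCommutator R (n + 1) c ↔ ∃ C, IsAdj B C ∧ CommEq R T T' C := by
  constructor
  · rintro ⟨b, hb, hl⟩
    obtain ⟨C, hC, hbC⟩ := hl (n + 1) le_rfl
    exact ⟨C, hC, h.commEq_of_intertwine e e' hbC hb⟩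
  · rintro ⟨C, hC, hCe⟩
    obtain ⟨b, hb, hl⟩ := hc
    refine ⟨b, hb, fun k hk => ?_⟩
    rcases Nat.lt_or_eq_of_le hk with hk | rfl
    · exact hl k (Nat.lt_succ_iff.1 hk)
    · exact ⟨C, hC, h.intertwine_of_commEq hl.isAdj hC e e' hb hCe⟩

variable (M) in
/-- `θ_n(a)` has the diagonal entries `T = (D + i)^n a (D + i)^(-n)` on the range of `p₁ ⋯ p_n` and
`V` on the range of `p₁^⊥ ⋯ p_n^⊥`, where `V* = (D + i)^n a* (D + i)^(-n)` up to the grading. -/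
def ThetaForm (D : E →ₗ.[ℂ] E) (R S : Module.End ℂ E) (n : ℕ) (a : A) : Prop :=
  ∃ T V Vs : Module.End ℂ E, IsAdj B T ∧ AdjPair B V Vs ∧ M.rep a * R ^ n = R ^ n * T ∧
    M.rep (M.gradA^[n] (star a)) * R ^ n = R ^ n * Vs ∧ M.theta D n a = corner B R S n T V

lemma mem_sobolev_one_iff (hodd : M.IsOdd D) (h : ResolventPair B D R S) {a : A} :
    a ∈ M.sobolev D 1 ↔ M.SmoothCommutator R 0 a ∧ M.SmoothCommutator R 0 (star a) := by
  have h1 : a ∈ M.sobolev D 1 ↔ M.SmoothCommutator R 0 a := by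
    rw [smoothCommutator_zero_iff, ← memEnd_diag_zero_iff h]
    exact and_iff_right trivial
  -- The condition on a* is automatic: [D, γ(a*)] is -[D,a]*, and smoothness is invariant under γ.
  refine h1.trans ⟨fun ha => ⟨ha, ?_⟩, And.left⟩
  obtain ⟨C, ⟨Cs, hC⟩, e⟩ := smoothCommutator_zero_iff.1 ha
  have e' := h.commEq_adjoint (M.adjPair_rep a) (M.adjPair_rep _) hC e
  rw [← smoothCommutator_gradA_iff hodd h, smoothCommutator_zero_iff, M.gradA_gradA]
  rw [← map_star] at e'
  exact ⟨-Cs, ⟨_, hC.symm.neg⟩, e'⟩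

lemma thetaForm_one (h : ResolventPair B D R S) {a : A} (ha : a ∈ M.sobolev D 1) :
    M.ThetaForm D R S 1 a := by
  obtain ⟨C, ⟨Cs, hC⟩, e⟩ := (memEnd_diag_zero_iff h).1 ha.2
  have hx := extension_pdiag_spec h.res ha.2
  -- `extension` is a choice, but adjointable extensions of the commutator are unique, so it equals
  -- the explicit one.
  have he : extension B (gradedCommutator (pdiag 0 D) (M.theta D 0 a) (M.theta D 0 (M.gradA a))) =
      diag 0 C := commEq_unique (h.diag 0) hx.1 ⟨_, hC.diag 0⟩ hx.2
        (LinearMap.ext fun x => funext fun i => LinearMap.congr_fun e (x i))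
  have e' := h.commEq_adjoint (M.adjPair_rep a) (M.adjPair_rep _) hC e
  refine ⟨next R (M.rep a) (M.rep (M.gradA a)) C,
    lowerNext R S (M.rep a) (M.rep (M.gradA a)) C, _,
    h.isAdj_next (M.isAdj_rep a) (M.isAdj_rep _) ⟨_, hC⟩,
    adjPair_lowerNext h (M.adjPair_rep a) (M.adjPair_rep _) hC e, ?_, ?_, ?_⟩
  · rw [pow_one]
    exact e
  · rw [pow_one, Function.iterate_one, map_star]
    exact e'
  · rw [theta, he]
    exact compress_zero_diag h.res h.res' e

lemma mem_sobolev_succ_succ (hodd : M.IsOdd D) (h : ResolventPair B D R S) {n : ℕ}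
    (ih : ∀ a, a ∈ M.sobolev D (n + 1) ↔
      M.SmoothCommutator R n a ∧ M.SmoothCommutator R n (star a))
    (ihθ : ∀ a ∈ M.sobolev D (n + 1), M.ThetaForm D R S (n + 1) a) (a : A) :
    (a ∈ M.sobolev D (n + 2) ↔
      M.SmoothCommutator R (n + 1) a ∧ M.SmoothCommutator R (n + 1) (star a)) ∧
    (a ∈ M.sobolev D (n + 2) → M.ThetaForm D R S (n + 2) a) := by
  -- θ_{n+1}(a) has the corner form only on A_{n+1}; off A_{n+1} both sides of the equivalence fail.
  by_cases ha : a ∈ M.sobolev D (n + 1)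
  swap
  · refine ⟨⟨fun h' => absurd h'.1 ha, fun h' => absurd ?_ ha⟩, fun h' => absurd h'.1 ha⟩
    exact (ih a).2 ⟨h'.1.mono n.le_succ, h'.2.mono n.le_succ⟩
  have hs := (ih a).1 ha
  have hγ : M.gradA a ∈ M.sobolev D (n + 1) := by
    rw [ih, ← map_star]
    exact ⟨hs.1.gradA hodd h, hs.2.gradA hodd h⟩
  obtain ⟨T, V, Vs, hT, hV, eT, eV, eθ⟩ := ihθ a ha
  obtain ⟨T', V', Vs', hT', hV', eT', eV', eθ'⟩ := ihθ _ hγ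
  rw [← map_star, ← Function.iterate_succ_apply] at eV'
  have hmem : a ∈ M.sobolev D (n + 2) ↔
      (∃ C, IsAdj B C ∧ CommEq R T T' C) ∧ ∃ C, IsAdj B C ∧ CommEq R V V' C := by
    rw [← memEnd_corner_iff h, ← eθ, ← eθ']
    exact and_iff_right ha
  have hadj : (∃ C, IsAdj B C ∧ CommEq R V V' C) ↔ ∃ C, IsAdj B C ∧ CommEq R Vs' Vs C := by
    constructor
    · rintro ⟨C, ⟨Cs, hC⟩, e⟩
      exact ⟨-Cs, ⟨_, hC.symm.neg⟩, h.commEq_adjoint hV hV' hC e⟩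
    · rintro ⟨C, ⟨Cs, hC⟩, e⟩
      exact ⟨-Cs, ⟨_, hC.symm.neg⟩, h.commEq_adjoint hV'.symm hV.symm hC e⟩
  have hstar : M.SmoothCommutator R (n + 1) (star a) ↔
      ∃ C, IsAdj B C ∧ CommEq R Vs' Vs C := by
    -- The lift of γ^(n+2)(a*) is `Vs'`, coming from the corner for γ(a). Its grading conjugate is
    -- γ^(n+1)(a*), with lift `Vs`, since γ² = 1.
    rw [← smoothCommutator_iterate_gradA_iff hodd h (n + 2)]
    refine smoothCommutator_succ_iff h
      ((smoothCommutator_iterate_gradA_iff hodd h (n + 2)).2 hs.2) eV' ?_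
    rw [Function.iterate_succ_apply', M.gradA_gradA]
    exact eV
  refine ⟨?_, fun ha2 => ?_⟩
  · rw [hmem, hadj, hstar, smoothCommutator_succ_iff h hs.1 eT eT']
  · obtain ⟨⟨C, hC, e⟩, ⟨C', ⟨Cs', hC'⟩, e'⟩⟩ := hmem.1 ha2
    have hx := extension_pdiag_spec h.res ha2.2
    have he : extension B (gradedCommutator (pdiag (n + 1) D) (M.theta D (n + 1) a)
        (M.theta D (n + 1) (M.gradA a))) = corner B R S (n + 1) C C' := by
      refine commEq_unique (h.diag _) hx.1 (h.isAdj_corner _ hC ⟨_, hC'⟩) hx.2 ?_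
      rw [eθ, eθ']
      exact commEq_corner h.rel e e'
    have e'' := h.commEq_adjoint hV hV' hC' e'
    refine ⟨next R T T' C, lowerNext R S V V' C', _, h.isAdj_next hT hT' hC,
      adjPair_lowerNext h hV hV' hC' e', intertwine_next e eT, intertwine_next e'' eV', ?_⟩
    rw [theta, he, eθ, eθ']
    exact compress_succ_corner h.res h.res' e e'

lemma mem_sobolev_succ_iff (hodd : M.IsOdd D) (h : ResolventPair B D R S) (n : ℕ) :
    (∀ a, a ∈ M.sobolev D (n + 1) ↔
      M.SmoothCommutator R n a ∧ M.SmoothCommutator R n (star a)) ∧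
    ∀ a ∈ M.sobolev D (n + 1), M.ThetaForm D R S (n + 1) a := by
  induction n with
  | zero => exact ⟨fun _ => mem_sobolev_one_iff hodd h, fun _ => thetaForm_one h⟩
  | succ n ih =>
    have := mem_sobolev_succ_succ hodd h ih.1 ih.2
    exact ⟨fun a => (this a).1, fun a => (this a).2⟩

end GradedBimodule

end Theta

/-! ### Stability properties of liftable operators -/

section LiftAlgebra

variable {B : Type*} [NonUnitalCStarAlgebra B] [PartialOrder B]
variable {X : Type*} [AddCommGroup X] [Module ℂ X] [Norm X] [SMul B X] [CStarModule B X]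
variable {R S T T' : Module.End ℂ X} {m : ℕ} {D : X →ₗ.[ℂ] X}

lemma Liftable.add (h : Liftable B R m T) (h' : Liftable B R m T') :
    Liftable B R m (T + T') := fun k hk => by
  obtain ⟨C, hC, e⟩ := h k hk
  obtain ⟨C', hC', e'⟩ := h' k hk
  exact ⟨C + C', hC.add hC', by rw [add_mul, e, e', mul_add]⟩

lemma Liftable.smul (h : Liftable B R m T) (c : ℂ) : Liftable B R m (c • T) := fun k hk => by
  obtain ⟨C, hC, e⟩ := h k hk
  exact ⟨c • C, hC.smul c, by rw [smul_mul_assoc, e, mul_smul_comm]⟩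

lemma Liftable.mul_right (h : Liftable B R m T) {Q : Module.End ℂ X} (hQ : IsAdj B Q)
    (hc : Commute Q R) : Liftable B R m (T * Q) := fun k hk => by
  obtain ⟨C, hC, e⟩ := h k hk
  exact ⟨C * Q, hC.mul hQ, by rw [mul_assoc, (hc.pow_right k).eq, ← mul_assoc, e, mul_assoc]⟩

lemma Liftable.mul_left (h : Liftable B R m T) {Q : Module.End ℂ X} (hQ : IsAdj B Q)
    (hc : Commute Q R) : Liftable B R m (Q * T) := fun k hk => by
  obtain ⟨C, hC, e⟩ := h k hk
  exact ⟨Q * C, hQ.mul hC, by rw [mul_assoc, e, ← mul_assoc, (hc.pow_right k).eq, mul_assoc]⟩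

lemma Liftable.exists_lift (hR : IsResolvent D R I) (h : Liftable B R (m + 1) T) :
    ∃ L, T * R = R * L ∧ Liftable B R m L := by
  obtain ⟨L, _, e⟩ := h 1 (Nat.le_add_left 1 m)
  rw [pow_one] at e
  refine ⟨L, e, fun k hk => ?_⟩
  obtain ⟨C, hC, e'⟩ := h (k + 1) (Nat.succ_le_succ hk)
  refine ⟨C, hC, hR.cancel_left ?_⟩
  rw [← mul_assoc, ← e, mul_assoc, ← pow_succ', e', pow_succ', mul_assoc]

lemma liftable_succ (hT : IsAdj B T) {L : Module.End ℂ X} (e : T * R = R * L)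
    (hL : Liftable B R m L) : Liftable B R (m + 1) T := fun k hk => by
  cases k with
  | zero => exact ⟨T, hT, by simp⟩
  | succ k =>
    obtain ⟨C, hC, e'⟩ := hL k (Nat.le_of_succ_le_succ hk)
    exact ⟨C, hC, by rw [pow_succ', ← mul_assoc, e, mul_assoc, e', mul_assoc]⟩

end LiftAlgebra

/-! ### Iterated commutators and relative boundedness -/

namespace GradedBimodule

variable {A B E : Type*} [NonUnitalCStarAlgebra A]
  [NonUnitalCStarAlgebra B] [PartialOrder B] [StarOrderedRing B]
  [NormedAddCommGroup E] [NormedSpace ℂ E] [SMul B E] [CStarModule B E]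
  {M : GradedBimodule A B E} {D : E →ₗ.[ℂ] E} {R S : Module.End ℂ E}

lemma hasValue_adPow_zero {c : A} {x z : E} : HasValue (M.adPow D 0 c) x z ↔ M.rep c x = z :=
  hasValue_everywhere

lemma hasValue_adPow_succ {k : ℕ} {c : A} {x z : E} :
    HasValue (M.adPow D (k + 1) c) x z ↔ ∃ u w y u', HasValue (M.adPow D k c) x u ∧
      HasValue D u w ∧ HasValue D x y ∧ HasValue (M.adPow D k (M.gradA c)) y u' ∧
      z = w - (-1 : ℂ) ^ k • u' := by
  simp only [adPow, hasValue_sub, hasValue_smul, hasValue_pcomp]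
  constructor
  · rintro ⟨w, _, ⟨u, hu, hw⟩, ⟨u', ⟨y, hy, hu'⟩, rfl⟩, rfl⟩
    exact ⟨u, w, y, u', hu, hw, hy, hu', rfl⟩
  · rintro ⟨u, w, y, u', hu, hw, hy, hu', rfl⟩
    exact ⟨w, _, ⟨u, hu, hw⟩, ⟨u', ⟨y, hy, hu'⟩, rfl⟩, rfl⟩

/-- Iterated commutators have formal adjoints. -/
lemma exists_inner_adPow (hD : IsSelfAdjointRegular B D) (k : ℕ) :
    ∃ s : ℂ, ∀ (c : A) (x u y v : E), HasValue (M.adPow D k c) x u →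
      HasValue (M.adPow D k (M.gradA^[k] (star c))) y v → inner B u y = s • inner B x v := by
  induction k with
  | zero =>
    refine ⟨1, fun c x u y v hu hv => ?_⟩
    rw [hasValue_adPow_zero] at hu hv
    rw [← hu, ← hv, M.inner_rep, one_smul]
    rfl
  | succ k ih =>
    obtain ⟨s, hs⟩ := ih
    refine ⟨-((-1) ^ k * s), fun c x u y v hu hv => ?_⟩
    obtain ⟨u₀, w, x₁, u', hu₀, hw, hx₁, hu', rfl⟩ := hasValue_adPow_succ.1 hu
    obtain ⟨v₀, w', y₁, v', hv₀, hw', hy₁, hv', rfl⟩ := hasValue_adPow_succ.1 hv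
    rw [Function.iterate_succ_apply', M.gradA_gradA] at hv'
    rw [Function.iterate_succ_apply, map_star] at hv₀
    -- The two terms of the graded commutator trade places under the adjoint. The extra γ in each
    -- step matches the twist in the second term.
    have e1 : inner B w y = s • inner B x v' := by
      rw [← hs c x u₀ y₁ v' hu₀ hv', ← hD.inner_eq hw hy₁]
    have e2 : inner B u' y = s • inner B x w' := by
      rw [hs _ _ _ _ _ hu' hv₀, hD.inner_eq hx₁ hw']
    have hsq : ((-1 : ℂ) ^ k) * (-1) ^ k = 1 := by rw [← mul_pow]; simp
    simp only [CStarModule.inner_sub_left, CStarModule.inner_sub_right,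
      CStarModule.inner_smul_left_complex, CStarModule.inner_smul_right_complex, e1, e2, smul_sub,
      smul_smul, star_pow, star_neg, star_one]
    rw [show -((-1 : ℂ) ^ k * s) * (-1) ^ k = -s * ((-1) ^ k * (-1) ^ k) by ring, hsq]
    module

lemma hasValue_adPow_gradE (hodd : M.IsOdd D) {k : ℕ} {c : A} {x u : E}
    (h : HasValue (M.adPow D k c) x u) :
    HasValue (M.adPow D k (M.gradA c)) (M.gradE x) ((-1 : ℂ) ^ k • M.gradE u) := by
  induction k generalizing c x u with
  | zero =>
    rw [hasValue_adPow_zero] at h ⊢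
    rw [← M.gradE_rep, h, pow_zero, one_smul]
  | succ k ih =>
    obtain ⟨u₀, w, y, u', hu₀, hw, hy, hu', rfl⟩ := hasValue_adPow_succ.1 h
    have hgu' := (ih hu').smul (-1)
    rw [neg_one_smul] at hgu'
    refine hasValue_adPow_succ.2 ⟨_, _, _, _, ih hu₀, (hodd.hasValue hw).smul _,
      hodd.hasValue hy, hgu', ?_⟩
    rw [map_sub, map_smul, pow_succ]
    module

variable (M) in
/-- `N` extends `(ad D)^(k+1)(c) (D + i)^(-k)`, in terms of `R = (D + i)⁻¹`. -/
def ExtendsAd (D : E →ₗ.[ℂ] E) (R : Module.End ℂ E) (k : ℕ) (c : A) (N : Module.End ℂ E) : Prop :=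
  ∀ y, HasValue (M.adPow D (k + 1) c) ((R ^ (k + 1)) y) (N (R y))

lemma extendsAd_zero_iff (h : IsResolvent D R I) {c : A} {N : Module.End ℂ E} :
    M.ExtendsAd D R 0 c N ↔ CommEq R (M.rep c) (M.rep (M.gradA c)) N := by
  constructor
  · intro hN
    refine LinearMap.ext fun x => ?_
    obtain ⟨u, w, y, u', hu, hw, hy, hu', e⟩ := hasValue_adPow_succ.1 (hN x)
    rw [zero_add, pow_one] at hu hy
    rw [hasValue_adPow_zero] at hu hu'
    rw [hy.unique (h.value_bddPart x)] at hu'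
    have h1 := h.left_inv hw
    rw [pow_zero, one_smul, eq_sub_iff_add_eq, ← hu'] at e
    rw [← e, ← hu] at h1
    exact h1.symm
  · intro hN x
    have hN' : ∀ u, M.rep c (R u) =
      R (N (R u) + M.rep (M.gradA c) (bddPart R u) + I • M.rep c (R u)) := LinearMap.congr_fun hN
    have hw := h.value (N (R x) + M.rep (M.gradA c) (bddPart R x) + I • M.rep c (R x))
    rw [← hN', add_sub_cancel_right] at hw
    rw [zero_add, pow_one]
    refine hasValue_adPow_succ.2 ⟨_, _, _, _, hasValue_adPow_zero.2 rfl, hw, h.value_bddPart x,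
      hasValue_adPow_zero.2 rfl, ?_⟩
    rw [pow_zero, one_smul, add_sub_cancel_right]

lemma bddPart_pow_apply (k : ℕ) (y : E) : bddPart R ((R ^ k) y) = (R ^ k) (bddPart R y) :=
  (LinearMap.congr_fun ((commute_bddPart (Commute.refl R)).pow_left k) y).symm

lemma bddPart_apply_comm (y : E) : bddPart R (R y) = R (bddPart R y) :=
  (LinearMap.congr_fun (commute_bddPart (Commute.refl R)) y).symm

/-- Multiply the recursion for (ad D)^(k+2)(c) by R^(k+1): the first term is DNR = DR·L, the second
is N'DR. -/
lemma ExtendsAd.succ (h : IsResolvent D R I) {k : ℕ} {c : A} {N N' L : Module.End ℂ E}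
    (hN : M.ExtendsAd D R k c N) (hN' : M.ExtendsAd D R k (M.gradA c) N') (e : N * R = R * L) :
    M.ExtendsAd D R (k + 1) c (bddPart R * L + (-1 : ℂ) ^ k • (N' * bddPart R)) := fun y => by
  have e' : ∀ x, N (R x) = R (L x) := LinearMap.congr_fun e
  have h1 := hN (R y)
  rw [e', ← Module.End.mul_apply, ← pow_succ] at h1
  have h2 := h.value_bddPart ((R ^ (k + 1)) y)
  rw [← Module.End.mul_apply R, ← pow_succ', bddPart_pow_apply] at h2
  refine hasValue_adPow_succ.2 ⟨_, _, _, _, h1, h.value_bddPart _, h2, hN' _, ?_⟩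
  simp only [LinearMap.add_apply, LinearMap.smul_apply, Module.End.mul_apply, bddPart_apply_comm]
  rw [pow_succ]
  module

lemma ExtendsAd.exists_lift (h : ResolventPair B D R S) {k : ℕ} {c : A}
    {N N' N'' : Module.End ℂ E} (hNa : IsAdj B N) (hNa' : IsAdj B N') (hNa'' : IsAdj B N'')
    (hN : M.ExtendsAd D R k c N) (hN' : M.ExtendsAd D R k (M.gradA c) N')
    (hN'' : M.ExtendsAd D R (k + 1) c N'') :
    ∃ L, N * R = R * L ∧ N'' = bddPart R * L + (-1 : ℂ) ^ k • (N' * bddPart R) := by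
  -- The recursion solved for (D+i)NR, using DNR = N'' - (-1)^k N'DR.
  set L := N'' - (-1 : ℂ) ^ k • (N' * bddPart R) + I • (N * R) with hL
  have hLa : IsAdj B L :=
    (hNa''.sub ((hNa'.mul h.isAdj_bddPart).smul _)).add ((hNa.mul h.isAdj).smul _)
  have e : N * R = R * L := by
    refine h.cancel_right (hNa.mul h.isAdj) (h.isAdj.mul hLa) (LinearMap.ext fun y => ?_)
    obtain ⟨u, w, y₁, u', hu, hw, hy₁, hu', e⟩ := hasValue_adPow_succ.1 (hN'' y)
    have h1 := hN (R y)
    rw [← Module.End.mul_apply, ← pow_succ] at h1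
    have h2 := h.res.value_bddPart ((R ^ (k + 1)) y)
    rw [← Module.End.mul_apply R, ← pow_succ', bddPart_pow_apply] at h2
    rw [hy₁.unique h2] at hu'
    rw [hu.unique h1] at hw
    rw [hu'.unique (hN' _), eq_sub_iff_add_eq] at e
    have h3 := h.res.left_inv hw
    refine h3.symm.trans (congrArg R ?_)
    rw [← e, hL]
    simp only [LinearMap.add_apply, LinearMap.sub_apply, LinearMap.smul_apply,
      Module.End.mul_apply, bddPart_apply_comm]
    rw [pow_succ]
    module
  refine ⟨L, e, ?_⟩
  rw [bddPart, sub_mul, one_mul, smul_mul_assoc, ← e, hL]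
  simp only [bddPart]
  abel

/-- Each further commutator uses up one order of liftability, so k + j stays equal to n. -/
lemma SmoothCommutator.exists_extendsAd (hodd : M.IsOdd D) (h : ResolventPair B D R S) {n : ℕ}
    {c : A} (hc : M.SmoothCommutator R n c) {k j : ℕ} (hk : k + j = n) :
    ∃ N, M.ExtendsAd D R k c N ∧ Liftable B R j N := by
  induction k generalizing j c with
  | zero =>
    obtain ⟨b, hb, hl⟩ := hc
    rw [zero_add] at hk
    exact ⟨b, (extendsAd_zero_iff h.res).2 hb, hk ▸ hl⟩
  | succ k ih =>
    obtain ⟨N, hN, hl⟩ := ih hc (j := j + 1) (by omega)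
    obtain ⟨N', hN', hl'⟩ := ih (hc.gradA hodd h) (j := j + 1) (by omega)
    obtain ⟨L, e, hL⟩ := hl.exists_lift h.res
    have hcomm := (commute_bddPart (Commute.refl R)).symm
    exact ⟨_, hN.succ h.res hN' e, (hL.mul_left h.isAdj_bddPart hcomm).add
      (((hl'.mono j.le_succ).mul_right h.isAdj_bddPart hcomm).smul _)⟩

/-- N lifts to order l+1 once L lifts to order l, and L is built from N'' (one commutator more,
outer induction) and from N, N' (lower order, inner induction). -/
lemma liftable_of_extendsAd (h : ResolventPair B D R S) {n : ℕ} {P : A → Prop}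
    (hP : ∀ c, P c → P (M.gradA c))
    (had : ∀ c, P c → ∀ k ≤ n, ∃ N, IsAdj B N ∧ M.ExtendsAd D R k c N) {k j : ℕ} (hk : k + j = n)
    {c : A} (hc : P c) {N : Module.End ℂ E} (hN : IsAdj B N) (hcN : M.ExtendsAd D R k c N) :
    Liftable B R j N := by
  induction j generalizing k c N with
  | zero => exact liftable_zero hN
  | succ j ih =>
    have hcomm := (commute_bddPart (Commute.refl R)).symm
    -- The inner statement ranges over all c, because L also involves the operator N' belonging to
    -- γ(c).
    suffices ∀ l ≤ j + 1, ∀ c, P c → ∀ N, IsAdj B N → M.ExtendsAd D R k c N → Liftable B R l N from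
      this _ le_rfl c hc N hN hcN
    intro l hl
    induction l with
    | zero => exact fun _ _ _ hN _ => liftable_zero hN
    | succ l ihl =>
      intro c hc N hN hcN
      have ihl := ihl (by omega)
      obtain ⟨N', hN', hcN'⟩ := had _ (hP c hc) k (by omega)
      obtain ⟨N'', hN'', hcN''⟩ := had c hc (k + 1) (by omega)
      obtain ⟨L, e, e'⟩ := hcN.exists_lift h hN hN' hN'' hcN' hcN''
      have h1 : Liftable B R l N'' := (ih (k := k + 1) (by omega) hc hN'' hcN'').mono (by omega)
      have h2 := ihl c hc N hN hcN
      have h3 := ihl _ (hP c hc) N' hN' hcN'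
      refine liftable_succ hN e ?_
      have e2 : L = N'' + (-((-1 : ℂ) ^ k)) • (N' * bddPart R) + I • (N * R) := by
        rw [e', e, bddPart]
        simp only [sub_mul, one_mul, smul_mul_assoc]
        module
      rw [e2]
      exact (h1.add ((h3.mul_right h.isAdj_bddPart hcomm).smul _)).add
        ((h2.mul_right h.isAdj (Commute.refl R)).smul _)

lemma smoothCommutator_of_extendsAd (h : ResolventPair B D R S) {n : ℕ} {P : A → Prop}
    (hP : ∀ c, P c → P (M.gradA c))
    (had : ∀ c, P c → ∀ k ≤ n, ∃ N, IsAdj B N ∧ M.ExtendsAd D R k c N) {c : A} (hc : P c) :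
    M.SmoothCommutator R n c := by
  obtain ⟨N, hN, hcN⟩ := had c hc 0 (Nat.zero_le n)
  exact ⟨N, (extendsAd_zero_iff h.res).1 hcN,
    liftable_of_extendsAd h hP had (zero_add n) hc hN hcN⟩

/-- The factorization of Q^k through R^k treats both signs at once. The operator for the adjoint
element is needed because the natural domain of the product may exceed Dom D, and the extension must
agree on all of it. -/
lemma ExtendsAd.memEnd (hD : IsSelfAdjointRegular B D) (h : ResolventPair B D R S) {k : ℕ} {c : A}
    {N N' : Module.End ℂ E} (hN : IsAdj B N) (hcN : M.ExtendsAd D R k c N)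
    (hcN' : M.ExtendsAd D R k (M.gradA^[k + 1] (star c)) N') {z : ℂ} {Q Q' W : Module.End ℂ E}
    (hQ : IsResolvent D Q z) (hQQ' : AdjPair B Q Q') (hW : IsAdj B W) (hWR : Commute W R)
    (hQW : Q ^ k = R ^ k * W) :
    MemEnd B D (pcomp (M.adPow D (k + 1) c) (ppow (resolvent D z) k)) := by
  have hval : ∀ x y, HasValue (pcomp (M.adPow D (k + 1) c) (ppow (resolvent D z) k)) x y ↔
      HasValue (M.adPow D (k + 1) c) ((Q ^ k) x) y := fun x y => by
    simp only [hasValue_pcomp, hQ.hasValue_ppow_resolvent, exists_eq_left]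
  have hWR' : ∀ x, W (R x) = R (W x) := LinearMap.congr_fun hWR
  have hR : ∀ y, HasValue (M.adPow D (k + 1) c) ((Q ^ k) (R y)) ((N * W) (R y)) := fun y => by
    have := hcN (W y)
    rw [pow_succ, Module.End.mul_apply, ← hWR', ← Module.End.mul_apply, ← hQW] at this
    exact this
  refine ⟨fun x hx => ?_, N * W, isAdjointable_iff.2 (hN.mul hW), fun x => ?_⟩
  · obtain ⟨y, rfl⟩ := h.res.exists_eq hx
    exact ((hval _ _).2 (hR y)).mem
  · obtain ⟨s, hs⟩ := exists_inner_adPow (M := M) hD (k + 1)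
    obtain ⟨T, hT⟩ := hN.mul hW
    have hx := (hval _ _).1 (hasValue_apply _ x)
    -- Testing S^(k+1) of both sides against y moves R^(k+1) onto y, which puts it in the domain of
    -- the formal adjoint.
    refine h.res'.pow_injective (k + 1) (eq_of_inner_right (B := B) fun y => ?_)
    rw [(h.adj.symm.pow (k + 1)) _ _, (h.adj.symm.pow (k + 1)) _ _, hs c _ _ _ _ hx (hcN' y), hT]
    -- The adjoint T is determined by pairing with the range of R, where the value of the commutator
    -- is already known.
    have key : T ((R ^ (k + 1)) y) = s • (Q' ^ k) (N' (R y)) := by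
      refine h.res'.injective (eq_of_inner_left (B := B) fun v => ?_)
      rw [← h.adj, ← h.adj, ← hT, hs c _ _ _ _ (hR v) (hcN' y), (hQQ'.pow k) _ _,
        CStarModule.inner_smul_right_complex]
    rw [key, CStarModule.inner_smul_right_complex, (hQQ'.pow k) _ _]

lemma SmoothCommutator.relBounded (hD : IsSelfAdjointRegular B D) (hodd : M.IsOdd D)
    (h : ResolventPair B D R S) {n : ℕ} {a : A} (ha : M.SmoothCommutator R n a)
    (ha' : M.SmoothCommutator R n (star a)) {k : ℕ} (hk : k ≤ n) : M.RelBounded D (k + 1) a := by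
  have key : ∀ b : A, M.SmoothCommutator R n b → M.SmoothCommutator R n (star b) →
      ∀ z ∈ ({I, -I} : Set ℂ),
      MemEnd B D (pcomp (M.adPow D (k + 1) b) (ppow (resolvent D z) k)) := by
    intro b hb hb' z hz
    obtain ⟨N, hN, hl⟩ := hb.exists_extendsAd hodd h (Nat.add_sub_of_le hk)
    obtain ⟨N', hN', -⟩ := ((smoothCommutator_iterate_gradA_iff hodd h (k + 1)).2
      hb').exists_extendsAd hodd h (Nat.add_sub_of_le hk)
    rcases hz with rfl | rfl
    · exact hN.memEnd hD h hl.isAdj hN' h.res h.adj IsAdj.one (Commute.one_left R) (mul_one _).symm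
    · refine hN.memEnd hD h hl.isAdj hN' h.res' h.adj.symm (h.isAdj_cayley'.pow k) ?_
        (pow_mul_cayley' h.rel k).symm
      exact ((Commute.one_left R).add_left (h.rel.comm.symm.smul_left _)).pow_left k
  rintro z hz b (rfl | rfl)
  · exact key b ha ha' z hz
  · exact key _ ha' (by rwa [star_star]) z hz

lemma exists_extendsAd_of_memEnd (h : ResolventPair B D R S) {k : ℕ} {c : A}
    (hm : MemEnd B D (pcomp (M.adPow D (k + 1) c) (ppow (resolvent D I) k))) :
    ∃ N, IsAdj B N ∧ M.ExtendsAd D R k c N := by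
  obtain ⟨hd, T, hT, e⟩ := hm
  refine ⟨T, isAdjointable_iff.1 hT, fun y => ?_⟩
  have hv := hasValue_apply _ ⟨R y, hd (h.res.value y).mem⟩
  rw [← e] at hv
  simp only [hasValue_pcomp, h.res.hasValue_ppow_resolvent, exists_eq_left] at hv
  rwa [pow_succ]

/-- Conjugation by the grading turns S into -R and c into γ(c), so the condition with -i becomes one
with +i for γ(c). -/
lemma exists_extendsAd_gradA_of_memEnd (hodd : M.IsOdd D) (h : ResolventPair B D R S) {k : ℕ}
    {c : A} (hm : MemEnd B D (pcomp (M.adPow D (k + 1) c) (ppow (resolvent D (-I)) k))) :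
    ∃ N, IsAdj B N ∧ M.ExtendsAd D R k (M.gradA c) N := by
  obtain ⟨hd, T, hT, e⟩ := hm
  have hgR := hodd.conj_resolvent h
  have hg := M.gradE_mul_gradE
  have hgS : (M.gradE : Module.End ℂ E) * S * M.gradE = -R := by
    rw [← neg_eq_iff_eq_neg.2 hgR, mul_neg, neg_mul, ← mul_assoc, ← mul_assoc, hg, one_mul,
      mul_assoc, hg, mul_one]
  refine ⟨-((M.gradE : Module.End ℂ E) * T * M.gradE),
    (M.isAdj_conj T (isAdjointable_iff.1 hT)).neg, fun y => ?_⟩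
  have hv := hasValue_apply _ ⟨S (M.gradE y), hd (h.res'.value (M.gradE y)).mem⟩
  rw [← e] at hv
  simp only [hasValue_pcomp, h.res'.hasValue_ppow_resolvent, exists_eq_left] at hv
  rw [← Module.End.mul_apply, ← pow_succ] at hv
  have hv' := (hasValue_adPow_gradE hodd hv).smul ((-1 : ℂ) ^ (k + 1))
  have e1 : (-1 : ℂ) ^ (k + 1) • M.gradE ((S ^ (k + 1)) (M.gradE y)) = (R ^ (k + 1)) y := by
    have := LinearMap.congr_fun (conj_pow hg hgS (k + 1)) y
    simp only [Module.End.mul_apply, LinearMap.smul_apply] at this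
    rw [this, smul_smul, ← mul_pow]
    simp
  have e2 : R y = -M.gradE (S (M.gradE y)) := by
    have := LinearMap.congr_fun hgS y
    simp only [Module.End.mul_apply, LinearMap.neg_apply] at this
    rw [this, neg_neg]
  rw [e1, smul_smul, ← mul_pow] at hv'
  convert hv' using 1
  rw [e2]
  simp [M.gradE_gradE]

lemma smoothCommutator_of_relBounded (hodd : M.IsOdd D) (h : ResolventPair B D R S) {n : ℕ} {a : A}
    (ha : ∀ k ≤ n, M.RelBounded D (k + 1) a) :
    M.SmoothCommutator R n a ∧ M.SmoothCommutator R n (star a) := by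
  have key : ∀ b ∈ ({a, star a} : Set A), ∀ k ≤ n,
      (∃ N, IsAdj B N ∧ M.ExtendsAd D R k b N) ∧
        ∃ N, IsAdj B N ∧ M.ExtendsAd D R k (M.gradA b) N := fun b hb k hk =>
    ⟨exists_extendsAd_of_memEnd h (ha k hk I (Or.inl rfl) b hb),
      exists_extendsAd_gradA_of_memEnd hodd h (ha k hk (-I) (Or.inr rfl) b hb)⟩
  have key' : ∀ b ∈ ({a, star a} : Set A), M.SmoothCommutator R n b := fun b hb => by
    -- The set {b, γ(b)} is stable under γ, which is the closure the recursion requires.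
    refine smoothCommutator_of_extendsAd (P := fun c => c = b ∨ c = M.gradA b) h ?_ ?_ (Or.inl rfl)
    · rintro c (rfl | rfl)
      · exact Or.inr rfl
      · exact Or.inl (M.gradA_gradA _)
    · rintro c (rfl | rfl) k hk
      · exact (key _ hb k hk).1
      · exact (key _ hb k hk).2
  exact ⟨key' a (Or.inl rfl), key' _ (Or.inr rfl)⟩

/-- The characterization of the Sobolev subalgebras by relatively bounded iterated commutators. -/
lemma mem_sobolev_succ_iff_relBounded [CompleteSpace E] (hD : IsSelfAdjointRegular B D)
    (hodd : M.IsOdd D) (n : ℕ) (a : A) :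
    a ∈ M.sobolev D (n + 1) ↔ ∀ k ≤ n, M.RelBounded D (k + 1) a := by
  obtain ⟨R, S, h⟩ := hD.exists_resolventPair
  rw [(mem_sobolev_succ_iff hodd h n).1 a]
  exact ⟨fun ha k hk => ha.1.relBounded hD hodd h ha.2 hk, smoothCommutator_of_relBounded hodd h⟩

end GradedBimodule

end SobolevChain

end

theorem mainTheorem8 {A B E : Type*} [NonUnitalCStarAlgebra A]
    [NonUnitalCStarAlgebra B] [PartialOrder B] [StarOrderedRing B]
    [NormedAddCommGroup E] [NormedSpace ℂ E] [SMul B E] [CStarModule B E] [CompleteSpace E]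
    (M : SobolevChain.GradedBimodule A B E) (D : E →ₗ.[ℂ] E)
    (hD : SobolevChain.IsSelfAdjointRegular B D) (hodd : M.IsOdd D)
    (n : ℕ) (hn : 1 ≤ n) (a : A) :
    (a ∈ M.sobolev D n ↔ ∀ k : ℕ, 1 ≤ k → k ≤ n → M.RelBounded D k a) ∧
      (a ∈ M.sobolev D (n - 1) → (a ∈ M.sobolev D n ↔ M.RelBounded D n a)) := by
  have key : ∀ n a, a ∈ M.sobolev D n ↔ ∀ k : ℕ, 1 ≤ k → k ≤ n → M.RelBounded D k a := by
    intro n a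
    cases n with
    | zero => exact ⟨fun _ k hk hk' => absurd (hk.trans hk') (by norm_num), fun _ => trivial⟩
    | succ n =>
      rw [SobolevChain.GradedBimodule.mem_sobolev_succ_iff_relBounded hD hodd]
      constructor
      · intro h k hk hk'
        obtain ⟨k, rfl⟩ := Nat.exists_eq_add_of_le' hk
        exact h k (Nat.le_of_succ_le_succ hk')
      · exact fun h k hk => h (k + 1) (Nat.le_add_left 1 k) (Nat.succ_le_succ hk)
  refine ⟨key n a, fun ha => ⟨fun h => (key n a).1 h n hn le_rfl, fun h => (key n a).2 ?_⟩⟩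
  -- The conditions with k < n come from a ∈ A_{n-1}; only k = n uses the new hypothesis.
  intro k hk hk'
  rcases Nat.lt_or_eq_of_le hk' with hlt | rfl
  · exact (key (n - 1) a).1 ha k hk (Nat.le_sub_one_of_lt hlt)
  · exact h
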